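/- **Source language.** Types are $\tau,\sigma ::= \mathbf{real}^n \mid \mathbf 1 \mid \tau*\sigma \mid \tau\to\sigma$ ($n\in\mathbb N$); a type is *first-order* if it contains no $\to$. Fix sets $\mathsf{Op}^m_{n_1,\dots,n_k}$ of primitive operations. Terms are those of the simply typed $\lambda$-calculus: variables, $\mathbf{let}\ x=t\ \mathbf{in}\ s$, $\mathsf{op}(t_1,\dots,t_k):\mathbf{real}^m$ for $t_i:\mathbf{real}^{n_i}$, $\langle\rangle$, $\langle t,s\rangle$, $\mathbf{fst}\,t$, $\mathbf{snd}\,t$, $\lambda x.t$, $t\,s$, taken up to renaming of bound variables. **Target language.** Cartesian types are $A,B ::= \mathbf{real}^n\mid\mathbf 1\mid A*B\mid A\to B\mid L\multimap M$ and linear types are $L,M::=\underline{\mathbf{real}}^n\mid\underline{\mathbf 1}\mid L*M\mid A\to L\mid {!A}\otimes L$. There are Cartesian judgements $\Gamma\vdash t:A$ and linear judgements $\Gamma;v:L\vdash t:M$ with one linear identifier. Cartesian terms are the source term formers together with $\underline\lambda v.t : L\multimap M$. Linear terms are $v$, $\mathbf{let}\,x=t\,\mathbf{in}\,s$, $\mathbf{let}\,v=t\,\mathbf{in}\,s$,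 primitive linear operations $\mathsf{lop}(t_1,\dots,t_k;s)$, $\langle\rangle$, pairs and projections, $\lambda x.t$ and $t\,s$ for powers $A\to L$, $!t\otimes s$ and $\mathbf{case}\ t\ \mathbf{of}\ !y\otimes v\to s$ for copowers, linear application $t\bullet s$, $\underline 0$ and $t+s$. An $n$-ary linear tuple type $L_1*\cdots*L_n$ is $((\underline{\mathbf 1}*L_1)*\cdots)*L_n$, with coprojections $\mathrm{coproj}_i(t)=\langle 0,\dots,t,\dots,0\rangle$. **Semantics.** Cartesian types denote sets ($\llbracket\mathbf{real}^n\rrbracket=\mathbb R^n$, with products and all functions, and $\llbracket L\multimap M\rrbracket$ the set of monoid homomorphisms). Linear types denote commutative monoids ($\mathbb R^n$ under addition, products, pointwise powers, and $\llbracket !A\otimes L\rrbracket=\bigoplus_{a\in\llbracket A\rrbracket}\llbracket L\rrbracket$). Each $\mathsf{op}$ denotes a $C^\infty$ function $\mathbb R^{n_1}\times\dots\times\mathbb R^{n_k}\to\mathbb R^m$, and each $\mathsf{lop}$ denotes a $C^\infty$ function that is additive in its linear arguments. Terms have the standard denotation: $\Gamma\vdash t:A$ denotes a function $\llbracket\Gamma\rrbracket\to\llbracket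 A\rrbracket$, and $\Gamma;v:L\vdash t:M$ denotes a function from $\llbracket\Gamma\rrbracket$ to the homomorphisms $\llbracket L\rrbracket\to\llbracket M\rrbracket$. **CHAD.** Suppose that for each $\mathsf{op}\in\mathsf{Op}^m_{n_1,\dots,n_k}$ there are given target terms $D\mathsf{op}$ and $D\mathsf{op}^t$ with $$x_1:\mathbf{real}^{n_1},\dots,x_k:\mathbf{real}^{n_k};\ v:\underline{\mathbf{real}}^{n_1}*\cdots*\underline{\mathbf{real}}^{n_k}\vdash D\mathsf{op}:\underline{\mathbf{real}}^m ,$$ $$x_1:\mathbf{real}^{n_1},\dots,x_k:\mathbf{real}^{n_k};\ v:\underline{\mathbf{real}}^{m}\vdash D\mathsf{op}^t:\underline{\mathbf{real}}^{n_1}*\cdots*\underline{\mathbf{real}}^{n_k},$$ which are correct: $\llbracket D\mathsf{op}\rrbracket=D\llbracket\mathsf{op}\rrbracket$ and $\llbracket D\mathsf{op}^t\rrbracket=(D\llbracket\mathsf{op}\rrbracket)^t$. *Forward types:* $\overrightarrow{\mathcal D}(\mathbf{real}^n)_1=\mathbf{real}^n$ and $\overrightarrow{\mathcal D}(\mathbf{real}^n)_2=\underline{\mathbf{real}}^n$.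 Both $(-)_1$ and $(-)_2$ commute with $\mathbf 1$ and $*$, and $\overrightarrow{\mathcal D}(\tau\to\sigma)_1=\overrightarrow{\mathcal D}(\tau)_1\to(\overrightarrow{\mathcal D}(\sigma)_1*(\overrightarrow{\mathcal D}(\tau)_2\multimap\overrightarrow{\mathcal D}(\sigma)_2))$, $\overrightarrow{\mathcal D}(\tau\to\sigma)_2=\overrightarrow{\mathcal D}(\tau)_1\to\overrightarrow{\mathcal D}(\sigma)_2$. *Reverse types:* the same clauses, except $\overleftarrow{\mathcal D}(\tau\to\sigma)_1=\overleftarrow{\mathcal D}(\tau)_1\to(\overleftarrow{\mathcal D}(\sigma)_1*(\overleftarrow{\mathcal D}(\sigma)_2\multimap\overleftarrow{\mathcal D}(\tau)_2))$ and $\overleftarrow{\mathcal D}(\tau\to\sigma)_2={!\overleftarrow{\mathcal D}(\tau)_1}\otimes\overleftarrow{\mathcal D}(\sigma)_2$. For a context $\Gamma=x_1:\tau_1,\dots,x_n:\tau_n$, $\mathcal D(\Gamma)_1$ is the context of the $x_i:\mathcal D(\tau_i)_1$ and $\mathcal D(\Gamma)_2=\mathcal D(\tau_1)_2*\cdots*\mathcal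 D(\tau_n)_2$. A source term $\Gamma\vdash t:\tau$ is transformed, by recursion on $t$, into $$\overrightarrow{\mathcal D}(\Gamma)_1\vdash\overrightarrow{\mathcal D}_\Gamma(t):\overrightarrow{\mathcal D}(\tau)_1*(\overrightarrow{\mathcal D}(\Gamma)_2\multimap\overrightarrow{\mathcal D}(\tau)_2),\qquad \overleftarrow{\mathcal D}(\Gamma)_1\vdash\overleftarrow{\mathcal D}_\Gamma(t):\overleftarrow{\mathcal D}(\tau)_1*(\overleftarrow{\mathcal D}(\tau)_2\multimap\overleftarrow{\mathcal D}(\Gamma)_2).$$ Below, $\langle x,x'\rangle$, $\langle y,y'\rangle$ and $\langle x_i,x_i'\rangle$ are $\mathbf{let}$-bound to the transforms of $t$, $s$ and $t_i$ (in context $\Gamma$, or $\Gamma,x$ for the body $s$ of a $\mathbf{let}$), bound variables are fresh, and each line gives the resulting pair, forward first, then reverse. - $x_i$: $\langle x_i,\underline\lambda v.\,\mathrm{proj}_i v\rangle$; $\langle x_i,\underline\lambda v.\,\mathrm{coproj}_i v\rangle$. - $\mathbf{let}\,x=t\,\mathbf{in}\,s$: $\langle y,\underline\lambda v.\,y'\bullet\langle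 v,x'\bullet v\rangle\rangle$; $\langle y,\underline\lambda v.\,\mathbf{let}\,v=y'\bullet v\,\mathbf{in}\,\mathbf{fst}\,v+x'\bullet(\mathbf{snd}\,v)\rangle$. - $\mathsf{op}(t_1,\dots,t_k)$: $\langle\mathsf{op}(x_1,\dots,x_k),\underline\lambda v.\,D\mathsf{op}(x_1,\dots,x_k;\langle x_1'\bullet v,\dots,x_k'\bullet v\rangle)\rangle$; $\langle\mathsf{op}(x_1,\dots,x_k),\underline\lambda v.\,\mathbf{let}\,v=D\mathsf{op}^t(x_1,\dots,x_k;v)\,\mathbf{in}\,x_1'\bullet\mathrm{proj}_1v+\cdots+x_k'\bullet\mathrm{proj}_kv\rangle$. - $\langle\rangle$: $\langle\langle\rangle,\underline\lambda v.\langle\rangle\rangle$; $\langle\langle\rangle,\underline\lambda v.\underline0\rangle$. - $\langle t,s\rangle$: $\langle\langle x,y\rangle,\underline\lambda v.\langle x'\bullet v,y'\bullet v\rangle\rangle$; $\langle\langle x,y\rangle,\underline\lambda v.\,x'\bullet(\mathbf{fst}\,v)+y'\bullet(\mathbf{snd}\,v)\rangle$. - $\mathbf{fst}\,t$: $\langle\mathbf{fst}\,x,\underline\lambda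 v.\,\mathbf{fst}(x'\bullet v)\rangle$; $\langle\mathbf{fst}\,x,\underline\lambda v.\,x'\bullet\langle v,\underline0\rangle\rangle$; and similarly for $\mathbf{snd}$. - $\lambda x.t$, with $y=\lambda x.\,\mathcal D_{\Gamma,x}(t)$ and $\langle z,z'\rangle=y\,x$ in the first component: $\langle\lambda x.\langle z,\underline\lambda v.\,z'\bullet\langle\underline0,v\rangle\rangle,\ \underline\lambda v.\lambda x.(\mathbf{snd}(y\,x))\bullet\langle v,\underline0\rangle\rangle$; $\langle\lambda x.\langle z,\underline\lambda v.\,\mathbf{snd}(z'\bullet v)\rangle,\ \underline\lambda v.\,\mathbf{case}\,v\,\mathbf{of}\,!x\otimes v\to\mathbf{fst}((\mathbf{snd}(y\,x))\bullet v)\rangle$. - $t\,s$, with $\langle z,z'\rangle=x\,y$: $\langle z,\underline\lambda v.\,(x'\bullet v)\,y+z'\bullet(y'\bullet v)\rangle$; $\langle z,\underline\lambda v.\,x'\bullet(!y\otimes v)+y'\bullet(z'\bullet v)\rangle$. Write $\mathcal D_\Gamma(t)_1=\mathbf{fst}\,\mathcal D_\Gamma(t)$ and $\mathcal D_\Gamma(t)_2=(\mathbf{snd}\,\mathcal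 D_\Gamma(t))\bullet v$. **Theorem (correctness of AD).** Let $\Gamma\vdash t:\tau$ be a source term such that $\tau$ and all types in $\Gamma$ are first-order. Identify the denotations of $\Gamma$ and $\tau$, and of their types of primals, tangents and cotangents, with Euclidean spaces $\mathbb R^N$ and $\mathbb R^M$ by concatenation of coordinates. Then $\llbracket t\rrbracket$ is $C^\infty$, and $$\llbracket\overrightarrow{\mathcal D}_\Gamma(t)_1\rrbracket=\llbracket t\rrbracket,\quad\llbracket\overrightarrow{\mathcal D}_\Gamma(t)_2\rrbracket=D\llbracket t\rrbracket,\quad\llbracket\overleftarrow{\mathcal D}_\Gamma(t)_1\rrbracket=\llbracket t\rrbracket,\quad\llbracket\overleftarrow{\mathcal D}_\Gamma(t)_2\rrbracket=(D\llbracket t\rrbracket)^t,$$ where $D$ and $(-)^t$ are the usual derivative and matrix transpose. Hence $$\llbracket\overrightarrow{\mathcal D}_\Gamma(t)\rrbracket=(\llbracket t\rrbracket,D\llbracket t\rrbracket)\quad\text{and}\quad\llbracket\overleftarrow{\mathcal D}_\Gamma(t)\rrbracket=(\llbracket t\rrbracket,(D\llbracket t\rrbracket)^t).$$ -/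

import Mathlib

open scoped ContDiff

universe u

namespace CHAD

/-! ## Variables, types and signatures

Terms are intrinsically typed and use de Bruijn indices, so that they are given up to renaming of
bound variables.  Every list of types (a typing context, or the list of arities of a primitive
operation) is a snoc list: the head of the list is its last, most recently added, entry. -/

/-- `Var l a`: positions in the list `l` holding the entry `a` (typed de Bruijn indices). -/
inductive Var {α : Type} : List α → α → Type
  | here {l : List α} {a : α} : Var (a :: l) a
  | there {l : List α} {a b : α} : Var l a → Var (b :: l) a

/-- Types of the source language: real arrays, nullary and binary products, functions. -/
inductive Ty : Type
  | real (n : ℕ)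
  | unit
  | prod (σ τ : Ty)
  | fn (σ τ : Ty)

/-- First-order types: iterated (nullary and binary) products of types of real arrays. -/
def Ty.FirstOrder : Ty → Prop
  | .real _ => True
  | .unit => True
  | .prod σ τ => σ.FirstOrder ∧ τ.FirstOrder
  | .fn _ _ => False

mutual
/-- Cartesian types of the target language; `lfn L M` is the type of linear functions. -/
inductive CTy : Type
  | real (n : ℕ)
  | unit
  | prod (A B : CTy)
  | fn (A B : CTy)
  | lfn (L M : LTy)
/-- Linear types of the target language; `pow A L` is the power `A ⇒ L`, and `copow A L` is the
copower `!A ⊗ L`. -/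
inductive LTy : Type
  | real (n : ℕ)
  | unit
  | prod (L M : LTy)
  | pow (A : CTy) (L : LTy)
  | copow (A : CTy) (L : LTy)
end

/-- The linear `n`-ary tuple type `((1 * f a₁) * f a₂) * ⋯ * f aₙ`. -/
def ltuple {α : Type} (f : α → LTy) : List α → LTy
  | [] => .unit
  | a :: l => .prod (ltuple f l) (f a)

/-- The primitive operations: `Op ns m` is the set of operations taking arrays of the sizes `ns` to
an array of size `m`; `LOp ns ns' ms` is the set of linear operations with Cartesian arguments of
sizes `ns`, linear arguments of sizes `ns'` and results of sizes `ms`. -/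
structure Signature where
  Op : List ℕ → ℕ → Type u
  LOp : List ℕ → List ℕ → List ℕ → Type u

/-! ## Terms -/

/-- Terms `Γ ⊢ t : τ` of the source language. -/
inductive Tm (S : Signature.{u}) : List Ty → Ty → Type u
  | var {Γ : List Ty} {τ : Ty} : Var Γ τ → Tm S Γ τ
  | letE {Γ : List Ty} {σ τ : Ty} : Tm S Γ σ → Tm S (σ :: Γ) τ → Tm S Γ τ
  | op {Γ : List Ty} {ns : List ℕ} {m : ℕ} :
      S.Op ns m → (∀ n, Var ns n → Tm S Γ (.real n)) → Tm S Γ (.real m)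
  | unit {Γ : List Ty} : Tm S Γ .unit
  | pair {Γ : List Ty} {σ τ : Ty} : Tm S Γ σ → Tm S Γ τ → Tm S Γ (.prod σ τ)
  | fst {Γ : List Ty} {σ τ : Ty} : Tm S Γ (.prod σ τ) → Tm S Γ σ
  | snd {Γ : List Ty} {σ τ : Ty} : Tm S Γ (.prod σ τ) → Tm S Γ τ
  | lam {Γ : List Ty} {σ τ : Ty} : Tm S (σ :: Γ) τ → Tm S Γ (.fn σ τ)
  | app {Γ : List Ty} {σ τ : Ty} : Tm S Γ (.fn σ τ) → Tm S Γ σ → Tm S Γ τ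

mutual
/-- Cartesian terms `Γ ⊢ t : A` of the target language. -/
inductive CTm (S : Signature.{u}) : List CTy → CTy → Type u
  | var {Γ : List CTy} {A : CTy} : Var Γ A → CTm S Γ A
  | letE {Γ : List CTy} {A B : CTy} : CTm S Γ A → CTm S (A :: Γ) B → CTm S Γ B
  | op {Γ : List CTy} {ns : List ℕ} {m : ℕ} :
      S.Op ns m → (∀ n, Var ns n → CTm S Γ (.real n)) → CTm S Γ (.real m)
  | unit {Γ : List CTy} : CTm S Γ .unit
  | pair {Γ : List CTy} {A B : CTy} : CTm S Γ A → CTm S Γ B → CTm S Γ (.prod A B)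
  | fst {Γ : List CTy} {A B : CTy} : CTm S Γ (.prod A B) → CTm S Γ A
  | snd {Γ : List CTy} {A B : CTy} : CTm S Γ (.prod A B) → CTm S Γ B
  | lam {Γ : List CTy} {A B : CTy} : CTm S (A :: Γ) B → CTm S Γ (.fn A B)
  | app {Γ : List CTy} {A B : CTy} : CTm S Γ (.fn A B) → CTm S Γ A → CTm S Γ B
  | llam {Γ : List CTy} {L M : LTy} : LTm S Γ L M → CTm S Γ (.lfn L M)
/-- Linear terms `Γ; v : L ⊢ t : M` of the target language, with one linear identifier `v`.
`copow t s` is `!t ⊗ s`, `copowE t s` is `case t of !y ⊗ v → s`, `lapp t s` is the application of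
the linear function `t` to `s`. -/
inductive LTm (S : Signature.{u}) : List CTy → LTy → LTy → Type u
  | lvar {Γ : List CTy} {L : LTy} : LTm S Γ L L
  | letC {Γ : List CTy} {A : CTy} {L M : LTy} : CTm S Γ A → LTm S (A :: Γ) L M → LTm S Γ L M
  | letL {Γ : List CTy} {L M N : LTy} : LTm S Γ L M → LTm S Γ M N → LTm S Γ L N
  | lop {Γ : List CTy} {ns ns' ms : List ℕ} {L : LTy} :
      S.LOp ns ns' ms → (∀ n, Var ns n → CTm S Γ (.real n)) →
      LTm S Γ L (ltuple LTy.real ns') → LTm S Γ L (ltuple LTy.real ms)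
  | unit {Γ : List CTy} {L : LTy} : LTm S Γ L .unit
  | pair {Γ : List CTy} {L M N : LTy} : LTm S Γ L M → LTm S Γ L N → LTm S Γ L (.prod M N)
  | fst {Γ : List CTy} {L M N : LTy} : LTm S Γ L (.prod M N) → LTm S Γ L M
  | snd {Γ : List CTy} {L M N : LTy} : LTm S Γ L (.prod M N) → LTm S Γ L N
  | lam {Γ : List CTy} {A : CTy} {L M : LTy} : LTm S (A :: Γ) L M → LTm S Γ L (.pow A M)
  | app {Γ : List CTy} {A : CTy} {L M : LTy} : LTm S Γ L (.pow A M) → CTm S Γ A → LTm S Γ L M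
  | copow {Γ : List CTy} {A : CTy} {L M : LTy} :
      CTm S Γ A → LTm S Γ L M → LTm S Γ L (.copow A M)
  | copowE {Γ : List CTy} {A : CTy} {L M N : LTy} :
      LTm S Γ L (.copow A M) → LTm S (A :: Γ) M N → LTm S Γ L N
  | lapp {Γ : List CTy} {L M N : LTy} : CTm S Γ (.lfn M N) → LTm S Γ L M → LTm S Γ L N
  | zero {Γ : List CTy} {L M : LTy} : LTm S Γ L M
  | add {Γ : List CTy} {L M : LTy} : LTm S Γ L M → LTm S Γ L M → LTm S Γ L M
end

/-! ## Denotational semantics in sets and commutative monoids -/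

/-- The Euclidean space `ℝ^ι`. -/
abbrev E (ι : Type) : Type := EuclideanSpace ℝ ι

/-- The space `ℝⁿ`. -/
abbrev Rn (n : ℕ) : Type := E (Fin n)

/-- Denotation of source types as sets. -/
def Ty.sem : Ty → Type
  | .real n => Rn n
  | .unit => PUnit
  | .prod σ τ => σ.sem × τ.sem
  | .fn σ τ => σ.sem → τ.sem

mutual
/-- Denotation of Cartesian types as sets. -/
noncomputable def CTy.sem : CTy → Type
  | .real n => Rn n
  | .unit => PUnit
  | .prod A B => A.sem × B.sem
  | .fn A B => A.sem → B.sem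
  | .lfn L M => L.sem →+ M.sem
/-- Denotation of linear types as commutative monoids.  The copower of `L` by a set `A` is the
direct sum of `A` many copies of `L`. -/
noncomputable def LTy.sem : LTy → AddCommMonCat.{0}
  | .real n => AddCommMonCat.of (Rn n)
  | .unit => AddCommMonCat.of PUnit
  | .prod L M => AddCommMonCat.of (L.sem × M.sem)
  | .pow A L => AddCommMonCat.of (A.sem → L.sem)
  | .copow A L => AddCommMonCat.of (A.sem →₀ L.sem)
end

/-- Environments: the denotation `(⟦a₁⟧ × ⋯) × ⟦aₙ⟧` of a list. -/
def Env {α : Type} (sem : α → Type) : List α → Type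
  | [] => PUnit
  | a :: l => Env sem l × sem a

def Env.lookup {α : Type} {sem : α → Type} : {l : List α} → {a : α} → Env sem l → Var l a → sem a
  | _, _, ρ, .here => ρ.2
  | _, _, ρ, .there x => Env.lookup ρ.1 x

def Env.ofFun {α : Type} {sem : α → Type} : {l : List α} → (∀ a, Var l a → sem a) → Env sem l
  | [], _ => PUnit.unit
  | _ :: _, g => (Env.ofFun fun a x => g a (.there x), g _ .here)

/-! ### Coordinates on iterated products of Euclidean spaces -/

/-- Coordinates on a singleton. -/
noncomputable def unitCoord : PUnit.{1} ≃ E Empty where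
  toFun _ := 0
  invFun _ := PUnit.unit
  left_inv _ := rfl
  right_inv _ := Subsingleton.elim _ _

/-- Coordinates on a product, by concatenation. -/
noncomputable def prodCoord {A B ι κ : Type} [Fintype ι] [Fintype κ] (eA : A ≃ E ι) (eB : B ≃ E κ) :
    A × B ≃ E (ι ⊕ κ) :=
  (eA.prodCongr eB).trans (EuclideanSpace.sumEquivProd (𝕜 := ℝ) (ι := ι) (κ := κ)).symm.toEquiv

/-- The index set of the coordinates of a list whose entry `a` has coordinates indexed by `c a`. -/
def ListCoord {α : Type} (c : α → Type) : List α → Type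
  | [] => Empty
  | a :: l => ListCoord c l ⊕ c a

instance instFintypeListCoord {α : Type} (c : α → Type) [∀ a, Fintype (c a)] :
    (l : List α) → Fintype (ListCoord c l)
  | [] => inferInstanceAs (Fintype Empty)
  | a :: l =>
    letI := instFintypeListCoord c l
    inferInstanceAs (Fintype (ListCoord c l ⊕ c a))

/-- Coordinates on the environments of the list `l.map f`. -/
noncomputable def Env.mapCoord {α β : Type} {sem : β → Type} {c : α → Type} [∀ a, Fintype (c a)]
    (f : α → β) : (l : List α) → (∀ a ∈ l, sem (f a) ≃ E (c a)) →
      Env sem (l.map f) ≃ E (ListCoord c l)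
  | [], _ => unitCoord
  | a :: l, e => prodCoord (Env.mapCoord f l fun b hb => e b (List.mem_cons_of_mem a hb))
      (e a List.mem_cons_self)

/-- Coordinates on the environments of the list `l`. -/
noncomputable def Env.coord {α : Type} {sem : α → Type} {c : α → Type} [∀ a, Fintype (c a)] :
    (l : List α) → (∀ a ∈ l, sem a ≃ E (c a)) → Env sem l ≃ E (ListCoord c l)
  | [], _ => unitCoord
  | a :: l, e => prodCoord (Env.coord l fun b hb => e b (List.mem_cons_of_mem a hb))
      (e a List.mem_cons_self)

/-- Coordinates on the linear tuple type `ltuple f l`. -/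
noncomputable def ltupleCoord {α : Type} {c : α → Type} [∀ a, Fintype (c a)]
    (f : α → LTy) : (l : List α) → (∀ a ∈ l, (f a).sem ≃ E (c a)) →
      (ltuple f l).sem ≃ E (ListCoord c l)
  | [], _ => unitCoord
  | a :: l, e => prodCoord (ltupleCoord f l fun b hb => e b (List.mem_cons_of_mem a hb))
      (e a List.mem_cons_self)

/-- A function written in coordinates. -/
def inCoords {A B ι κ : Type} (eA : A ≃ E ι) (eB : B ≃ E κ) (f : A → B) : E ι → E κ :=
  fun x => eB (f (eA.symm x))

/-- Index set `n₁ + ⋯ + nₖ` of the coordinates on `ℝ^{n₁} × ⋯ × ℝ^{nₖ}`. -/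
abbrev ArgCoord (ns : List ℕ) : Type := ListCoord Fin ns

/-- Coordinates on `ℝ^{n₁} × ⋯ × ℝ^{nₖ}`. -/
noncomputable def argCoord (ns : List ℕ) : Env Rn ns ≃ E (ArgCoord ns) :=
  Env.coord ns fun _ _ => Equiv.refl _

/-- Coordinates on the denotation of the context `x₁ : real n₁, …, xₖ : real nₖ`. -/
noncomputable def argCtxCoord (ns : List ℕ) : Env CTy.sem (ns.map CTy.real) ≃ E (ArgCoord ns) :=
  Env.mapCoord CTy.real ns fun _ _ => Equiv.refl _

/-- Coordinates on the denotation of the linear type `real n₁ * ⋯ * real nₖ`. -/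
noncomputable def argTupleCoord (ns : List ℕ) : (ltuple LTy.real ns).sem ≃ E (ArgCoord ns) :=
  ltupleCoord LTy.real ns fun _ _ => Equiv.refl _

/-! ### Interpretation of terms -/

/-- Interpretations of the primitive operations: the operations denote smooth functions, and the
linear operations denote smooth functions that are additive in their linear arguments. -/
structure Interp (S : Signature.{u}) where
  op : ∀ {ns : List ℕ} {m : ℕ}, S.Op ns m → Env Rn ns → Rn m
  op_smooth : ∀ {ns : List ℕ} {m : ℕ} (o : S.Op ns m),
    ContDiff ℝ ∞ (inCoords (argCoord ns) (Equiv.refl (Rn m)) (op o))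
  lop : ∀ {ns ns' ms : List ℕ}, S.LOp ns ns' ms → Env Rn ns →
    ((ltuple LTy.real ns').sem →+ (ltuple LTy.real ms).sem)
  lop_smooth : ∀ {ns ns' ms : List ℕ} (o : S.LOp ns ns' ms),
    ContDiff ℝ ∞ fun p : E (ArgCoord ns) × E (ArgCoord ns') =>
      argTupleCoord ms (lop o ((argCoord ns).symm p.1) ((argTupleCoord ns').symm p.2))

variable {S : Signature.{u}}

/-- Denotation of source terms. -/
def Tm.sem (I : Interp S) : {Γ : List Ty} → {τ : Ty} → Tm S Γ τ → Env Ty.sem Γ → τ.sem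
  | _, _, .var x, ρ => ρ.lookup x
  | _, _, .letE t s, ρ => s.sem I (ρ, t.sem I ρ)
  | _, _, .op o ts, ρ => I.op o (Env.ofFun fun n x => (ts n x).sem I ρ)
  | _, _, .unit, _ => PUnit.unit
  | _, _, .pair t s, ρ => (t.sem I ρ, s.sem I ρ)
  | _, _, .fst t, ρ => (t.sem I ρ).1
  | _, _, .snd t, ρ => (t.sem I ρ).2
  | _, _, .lam t, ρ => fun a => t.sem I (ρ, a)
  | _, _, .app t s, ρ => (t.sem I ρ) (s.sem I ρ)

mutual
/-- Denotation of Cartesian target terms. -/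
noncomputable def CTm.sem (I : Interp S) :
    {Γ : List CTy} → {A : CTy} → CTm S Γ A → Env CTy.sem Γ → A.sem
  | _, _, .var x, ρ => ρ.lookup x
  | _, _, .letE t s, ρ => s.sem I (ρ, t.sem I ρ)
  | _, _, .op o ts, ρ => I.op o (Env.ofFun fun n x => (ts n x).sem I ρ)
  | _, _, .unit, _ => PUnit.unit
  | _, _, .pair t s, ρ => (t.sem I ρ, s.sem I ρ)
  | _, _, .fst t, ρ => (t.sem I ρ).1
  | _, _, .snd t, ρ => (t.sem I ρ).2
  | _, _, .lam t, ρ => fun a => t.sem I (ρ, a)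
  | _, _, .app t s, ρ => (t.sem I ρ) (s.sem I ρ)
  | _, _, .llam t, ρ => t.sem I ρ
/-- Denotation of linear target terms, as families of monoid homomorphisms. -/
noncomputable def LTm.sem (I : Interp S) :
    {Γ : List CTy} → {L M : LTy} → LTm S Γ L M → Env CTy.sem Γ → (L.sem →+ M.sem)
  | _, _, _, .lvar, _ => AddMonoidHom.id _
  | _, _, _, .letC t s, ρ => s.sem I (ρ, t.sem I ρ)
  | _, _, _, .letL t s, ρ => (s.sem I ρ).comp (t.sem I ρ)
  | _, _, _, .lop o ts s, ρ =>
      (I.lop o (Env.ofFun fun n x => (ts n x).sem I ρ)).comp (s.sem I ρ)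
  | _, _, _, .unit, _ => 0
  | _, _, _, .pair t s, ρ => AddMonoidHom.prod (t.sem I ρ) (s.sem I ρ)
  | _, _, _, .fst (M := M) (N := N) t, ρ => (AddMonoidHom.fst M.sem N.sem).comp (t.sem I ρ)
  | _, _, _, .snd (M := M) (N := N) t, ρ => (AddMonoidHom.snd M.sem N.sem).comp (t.sem I ρ)
  | _, _, _, .lam t, ρ => AddMonoidHom.pi fun a => t.sem I (ρ, a)
  | _, _, _, .app (A := A) (M := M) t s, ρ =>
      (Pi.evalAddMonoidHom (fun _ : A.sem => M.sem) (s.sem I ρ)).comp (t.sem I ρ)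
  | _, _, _, .copow t s, ρ => (Finsupp.singleAddHom (t.sem I ρ)).comp (s.sem I ρ)
  | _, _, _, .copowE t s, ρ =>
      (Finsupp.liftAddHom fun a => s.sem I (ρ, a)).comp (t.sem I ρ)
  | _, _, _, .lapp (M := M) (N := N) t s, ρ =>
      AddMonoidHom.comp (t.sem I ρ : M.sem →+ N.sem) (s.sem I ρ)
  | _, _, _, .zero, _ => 0
  | _, _, _, .add t s, ρ => t.sem I ρ + s.sem I ρ
end

/-! ## The CHAD code transformations -/

/-! ### Renaming and syntactic sugar in the target language -/

/-- Renamings of identifiers. -/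
abbrev Ren (Γ Δ : List CTy) : Type := ∀ A, Var Γ A → Var Δ A

def Ren.lift {Γ Δ : List CTy} (r : Ren Γ Δ) (B : CTy) : Ren (B :: Γ) (B :: Δ)
  | _, .here => .here
  | _, .there x => .there (r _ x)

mutual
def CTm.rename : {Γ Δ : List CTy} → {A : CTy} → CTm S Γ A → Ren Γ Δ → CTm S Δ A
  | _, _, _, .var x, r => .var (r _ x)
  | _, _, _, .letE t s, r => .letE (t.rename r) (s.rename (r.lift _))
  | _, _, _, .op o ts, r => .op o fun n x => (ts n x).rename r
  | _, _, _, .unit, _ => .unit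
  | _, _, _, .pair t s, r => .pair (t.rename r) (s.rename r)
  | _, _, _, .fst t, r => .fst (t.rename r)
  | _, _, _, .snd t, r => .snd (t.rename r)
  | _, _, _, .lam t, r => .lam (t.rename (r.lift _))
  | _, _, _, .app t s, r => .app (t.rename r) (s.rename r)
  | _, _, _, .llam t, r => .llam (t.rename r)
def LTm.rename : {Γ Δ : List CTy} → {L M : LTy} → LTm S Γ L M → Ren Γ Δ → LTm S Δ L M
  | _, _, _, _, .lvar, _ => .lvar
  | _, _, _, _, .letC t s, r => .letC (t.rename r) (s.rename (r.lift _))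
  | _, _, _, _, .letL t s, r => .letL (t.rename r) (s.rename r)
  | _, _, _, _, .lop o ts s, r => .lop o (fun n x => (ts n x).rename r) (s.rename r)
  | _, _, _, _, .unit, _ => .unit
  | _, _, _, _, .pair t s, r => .pair (t.rename r) (s.rename r)
  | _, _, _, _, .fst t, r => .fst (t.rename r)
  | _, _, _, _, .snd t, r => .snd (t.rename r)
  | _, _, _, _, .lam t, r => .lam (t.rename (r.lift _))
  | _, _, _, _, .app t s, r => .app (t.rename r) (s.rename r)
  | _, _, _, _, .copow t s, r => .copow (t.rename r) (s.rename r)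
  | _, _, _, _, .copowE t s, r => .copowE (t.rename r) (s.rename (r.lift _))
  | _, _, _, _, .lapp t s, r => .lapp (t.rename r) (s.rename r)
  | _, _, _, _, .zero, _ => .zero
  | _, _, _, _, .add t s, r => .add (t.rename r) (s.rename r)
end

/-- Weakening by one identifier. -/
def CTm.wk {Γ : List CTy} {A B : CTy} (t : CTm S Γ A) : CTm S (B :: Γ) A :=
  t.rename fun _ x => .there x

/-- The tuple `let`: `let ⟨x, y⟩ = t in s`, that is,
`let z = t in let x = fst z in let y = snd z in s` with `z` fresh. -/
def plet {Γ : List CTy} {A B C : CTy} (t : CTm S Γ (.prod A B)) (s : CTm S (B :: A :: Γ) C) :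
    CTm S Γ C :=
  .letE t <| .letE (.fst (.var .here)) <| .letE (.snd (.var (.there .here))) <|
    s.rename (Ren.lift (Ren.lift (fun _ x => .there x) A) B)

section Identifiers
variable {Γ : List CTy} {A₀ A₁ A₂ A₃ A₄ : CTy}

/-! `vᵢ` is the identifier that was bound `i` steps before the last one. -/

abbrev v0 : CTm S (A₀ :: Γ) A₀ := .var .here
abbrev v1 : CTm S (A₀ :: A₁ :: Γ) A₁ := .var (.there .here)
abbrev v2 : CTm S (A₀ :: A₁ :: A₂ :: Γ) A₂ := .var (.there (.there .here))
abbrev v3 : CTm S (A₀ :: A₁ :: A₂ :: A₃ :: Γ) A₃ := .var (.there (.there (.there .here)))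
abbrev v4 : CTm S (A₀ :: A₁ :: A₂ :: A₃ :: A₄ :: Γ) A₄ :=
  .var (.there (.there (.there (.there .here))))

end Identifiers

/-- The projection `projᵢ t` out of an `n`-ary linear tuple. -/
def LTm.proj {α : Type} {f : α → LTy} {Γ : List CTy} {L : LTy} :
    {l : List α} → {a : α} → Var l a → LTm S Γ L (ltuple f l) → LTm S Γ L (f a)
  | _, _, .here, t => .snd t
  | _, _, .there x, t => LTm.proj x (.fst t)

/-- The coprojection `coprojᵢ t = ⟨0, …, 0, t, 0, …, 0⟩` into an `n`-ary linear tuple. -/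
def LTm.coproj {α : Type} {f : α → LTy} {Γ : List CTy} {L : LTy} :
    {l : List α} → {a : α} → Var l a → LTm S Γ L (f a) → LTm S Γ L (ltuple f l)
  | _, _, .here, t => .pair .zero t
  | _, _, .there x, t => .pair (LTm.coproj x t) .zero

/-- The `n`-ary linear tuple `⟨t₁, …, tₙ⟩`. -/
def LTm.tuple {α : Type} {f : α → LTy} {Γ : List CTy} {L : LTy} :
    {l : List α} → (∀ a, Var l a → LTm S Γ L (f a)) → LTm S Γ L (ltuple f l)
  | [], _ => .unit
  | _ :: _, ts => .pair (LTm.tuple fun a x => ts a (.there x)) (ts _ .here)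

/-- The `n`-ary sum `t₁ + ⋯ + tₙ`. -/
def LTm.sum {α : Type} {Γ : List CTy} {L M : LTy} :
    {l : List α} → (∀ a, Var l a → LTm S Γ L M) → LTm S Γ L M
  | [], _ => .zero
  | _ :: _, ts => .add (LTm.sum fun a x => ts a (.there x)) (ts _ .here)

/-- The iterated tuple `let`
`let ⟨x₁, x₁'⟩ = t₁ in ⋯ let ⟨xₖ, xₖ'⟩ = tₖ in body (x₁, …, xₖ; x₁', …, xₖ')`. -/
def pletMany {B : CTy} (F : ℕ → CTy) {Γ : List CTy} : (ns : List ℕ) →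
    (∀ n, Var ns n → CTm S Γ (.prod (.real n) (F n))) →
    (∀ Δ : List CTy, Ren Γ Δ → (∀ n, Var ns n → Var Δ (.real n)) →
      (∀ n, Var ns n → Var Δ (F n)) → CTm S Δ B) →
    CTm S Γ B
  | [], _, body => body Γ (fun _ x => x) (fun _ x => nomatch x) (fun _ x => nomatch x)
  | n :: ns, ts, body =>
    pletMany F ns (fun m x => ts m (.there x)) fun Δ r xs xs' =>
      plet ((ts n .here).rename r) <|
        body (F n :: .real n :: Δ) (fun _ x => .there (.there (r _ x)))
          (fun
            | _, .here => .there .here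
            | m, .there x => .there (.there (xs m x)))
          (fun
            | _, .here => .here
            | m, .there x => .there (.there (xs' m x)))

/-- The renaming of `x₁ : real n₁, …, xₖ : real nₖ` given by a list of identifiers. -/
def argRen {Δ : List CTy} : {ns : List ℕ} → (∀ n, Var ns n → Var Δ (.real n)) →
    Ren (ns.map CTy.real) Δ
  | _ :: _, xs, _, .here => xs _ .here
  | _ :: _, xs, _, .there x => argRen (fun n y => xs n (.there y)) _ x

/-- A choice of terms that implement the derivatives of the primitive operations:
`x₁ : real n₁, …, xₖ : real nₖ; v : real n₁ * ⋯ * real nₖ ⊢ fwd o : real m` and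
`x₁ : real n₁, …, xₖ : real nₖ; v : real m ⊢ rev o : real n₁ * ⋯ * real nₖ`. -/
structure Derivs (S : Signature.{u}) where
  fwd : ∀ {ns : List ℕ} {m : ℕ}, S.Op ns m →
    LTm S (ns.map CTy.real) (ltuple LTy.real ns) (.real m)
  rev : ∀ {ns : List ℕ} {m : ℕ}, S.Op ns m →
    LTm S (ns.map CTy.real) (.real m) (ltuple LTy.real ns)

/-! ### Forward mode -/

mutual
/-- Forward-mode primals. -/
def Ty.fwd₁ : Ty → CTy
  | .real n => .real n
  | .unit => .unit
  | .prod σ τ => .prod σ.fwd₁ τ.fwd₁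
  | .fn σ τ => .fn σ.fwd₁ (.prod τ.fwd₁ (.lfn σ.fwd₂ τ.fwd₂))
/-- Forward-mode tangents. -/
def Ty.fwd₂ : Ty → LTy
  | .real n => .real n
  | .unit => .unit
  | .prod σ τ => .prod σ.fwd₂ τ.fwd₂
  | .fn σ τ => .pow σ.fwd₁ τ.fwd₂
end

/-- Forward-mode primals of a context. -/
abbrev fwdCtx₁ (Γ : List Ty) : List CTy := Γ.map Ty.fwd₁

/-- Forward-mode tangents of a context. -/
abbrev fwdCtx₂ (Γ : List Ty) : LTy := ltuple Ty.fwd₂ Γ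

/-- The primal identifier of an identifier. -/
def Var.map {α β : Type} (f : α → β) : {l : List α} → {a : α} → Var l a → Var (l.map f) (f a)
  | _, _, .here => .here
  | _, _, .there x => .there (x.map f)

/-- The forward-mode CHAD transformation. -/
def Tm.fwd (P : Derivs S) : {Γ : List Ty} → {τ : Ty} → Tm S Γ τ →
    CTm S (fwdCtx₁ Γ) (.prod τ.fwd₁ (.lfn (fwdCtx₂ Γ) τ.fwd₂))
  | _, _, .var x => .pair (.var (x.map Ty.fwd₁)) (.llam (.proj x .lvar))
  | _, _, .letE t s =>
    plet (t.fwd P) <|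
    plet (s.fwd P).wk <|
    .pair v1 (.llam (.lapp v0 (.pair .lvar (.lapp v2 .lvar))))
  | Γ, _, .op (ns := ns) o ts =>
    pletMany (fun n => .lfn (fwdCtx₂ Γ) (.real n)) ns (fun n x => (ts n x).fwd P)
      fun _ _ xs xs' =>
        .pair (.op o fun n i => .var (xs n i))
          (.llam (.letL (.tuple fun n i => .lapp (.var (xs' n i)) .lvar)
            ((P.fwd o).rename (argRen xs))))
  | _, _, .unit => .pair .unit (.llam .unit)
  | _, _, .pair t s =>
    plet (t.fwd P) <|
    plet (s.fwd P).wk.wk <|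
    .pair (.pair v3 v1) (.llam (.pair (.lapp v2 .lvar) (.lapp v0 .lvar)))
  | _, _, .fst t => plet (t.fwd P) <| .pair (.fst v1) (.llam (.fst (.lapp v0 .lvar)))
  | _, _, .snd t => plet (t.fwd P) <| .pair (.snd v1) (.llam (.snd (.lapp v0 .lvar)))
  | _, _, .lam t =>
    .letE (.lam (t.fwd P)) <|
    .pair
      (.lam (plet (.app v1 v0) <| .pair v1 (.llam (.lapp v0 (.pair .zero .lvar)))))
      (.llam (.lam (.lapp (.snd (.app v1 v0)) (.pair .lvar .zero))))
  | _, _, .app t s =>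
    plet (t.fwd P) <|
    plet (s.fwd P).wk.wk <|
    plet (.app v3 v1) <|
    .pair v1 (.llam (.add (.app (.lapp v4 .lvar) v3) (.lapp v0 (.lapp v2 .lvar))))

/-- The primal computation of the forward-mode transformation. -/
def Tm.fwd₁ (P : Derivs S) {Γ : List Ty} {τ : Ty} (t : Tm S Γ τ) : CTm S (fwdCtx₁ Γ) τ.fwd₁ :=
  .fst (t.fwd P)

/-- The tangent computation of the forward-mode transformation. -/
def Tm.fwd₂ (P : Derivs S) {Γ : List Ty} {τ : Ty} (t : Tm S Γ τ) :
    LTm S (fwdCtx₁ Γ) (fwdCtx₂ Γ) τ.fwd₂ :=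
  .lapp (.snd (t.fwd P)) .lvar

/-! ### Reverse mode -/

mutual
/-- Reverse-mode primals. -/
def Ty.rev₁ : Ty → CTy
  | .real n => .real n
  | .unit => .unit
  | .prod σ τ => .prod σ.rev₁ τ.rev₁
  | .fn σ τ => .fn σ.rev₁ (.prod τ.rev₁ (.lfn τ.rev₂ σ.rev₂))
/-- Reverse-mode cotangents. -/
def Ty.rev₂ : Ty → LTy
  | .real n => .real n
  | .unit => .unit
  | .prod σ τ => .prod σ.rev₂ τ.rev₂
  | .fn σ τ => .copow σ.rev₁ τ.rev₂
end

/-- Reverse-mode primals of a context. -/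
abbrev revCtx₁ (Γ : List Ty) : List CTy := Γ.map Ty.rev₁

/-- Reverse-mode cotangents of a context. -/
abbrev revCtx₂ (Γ : List Ty) : LTy := ltuple Ty.rev₂ Γ

/-- The reverse-mode CHAD transformation. -/
def Tm.rev (P : Derivs S) : {Γ : List Ty} → {τ : Ty} → Tm S Γ τ →
    CTm S (revCtx₁ Γ) (.prod τ.rev₁ (.lfn τ.rev₂ (revCtx₂ Γ)))
  | _, _, .var x => .pair (.var (x.map Ty.rev₁)) (.llam (.coproj x .lvar))
  | _, _, .letE t s =>
    plet (t.rev P) <|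
    plet (s.rev P).wk <|
    .pair v1 (.llam (.letL (.lapp v0 .lvar) (.add (.fst .lvar) (.lapp v2 (.snd .lvar)))))
  | Γ, _, .op (ns := ns) o ts =>
    pletMany (fun n => .lfn (.real n) (revCtx₂ Γ)) ns (fun n x => (ts n x).rev P)
      fun _ _ xs xs' =>
        .pair (.op o fun n i => .var (xs n i))
          (.llam (.letL ((P.rev o).rename (argRen xs))
            (.sum fun n i => .lapp (.var (xs' n i)) (.proj i .lvar))))
  | _, _, .unit => .pair .unit (.llam .zero)
  | _, _, .pair t s =>
    plet (t.rev P) <|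
    plet (s.rev P).wk.wk <|
    .pair (.pair v3 v1) (.llam (.add (.lapp v2 (.fst .lvar)) (.lapp v0 (.snd .lvar))))
  | _, _, .fst t => plet (t.rev P) <| .pair (.fst v1) (.llam (.lapp v0 (.pair .lvar .zero)))
  | _, _, .snd t => plet (t.rev P) <| .pair (.snd v1) (.llam (.lapp v0 (.pair .zero .lvar)))
  | _, _, .lam t =>
    .letE (.lam (t.rev P)) <|
    .pair
      (.lam (plet (.app v1 v0) <| .pair v1 (.llam (.snd (.lapp v0 .lvar)))))
      (.llam (.copowE .lvar (.fst (.lapp (.snd (.app v1 v0)) .lvar))))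
  | _, _, .app t s =>
    plet (t.rev P) <|
    plet (s.rev P).wk.wk <|
    plet (.app v3 v1) <|
    .pair v1 (.llam (.add (.lapp v4 (.copow v3 .lvar)) (.lapp v2 (.lapp v0 .lvar))))

/-- The primal computation of the reverse-mode transformation. -/
def Tm.rev₁ (P : Derivs S) {Γ : List Ty} {τ : Ty} (t : Tm S Γ τ) : CTm S (revCtx₁ Γ) τ.rev₁ :=
  .fst (t.rev P)

/-- The cotangent computation of the reverse-mode transformation. -/
def Tm.rev₂ (P : Derivs S) {Γ : List Ty} {τ : Ty} (t : Tm S Γ τ) :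
    LTm S (revCtx₁ Γ) τ.rev₂ (revCtx₂ Γ) :=
  .lapp (.snd (t.rev P)) .lvar

/-! ## Derivatives at first-order types

At a first-order type `τ`, the denotations of `τ` and of its types of primals, tangents and
cotangents are all the same iterated product of Euclidean spaces.  They are identified with the
same space `ℝ^N` by concatenation of coordinates. -/

/-- The index set of the coordinates of a first-order type. -/
def Ty.Coord : Ty → Type
  | .real n => Fin n
  | .unit => Empty
  | .prod σ τ => σ.Coord ⊕ τ.Coord
  | .fn _ _ => Empty

instance instFintypeCoord : (τ : Ty) → Fintype τ.Coord
  | .real n => inferInstanceAs (Fintype (Fin n))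
  | .unit => inferInstanceAs (Fintype Empty)
  | .prod σ τ =>
    letI := instFintypeCoord σ
    letI := instFintypeCoord τ
    inferInstanceAs (Fintype (σ.Coord ⊕ τ.Coord))
  | .fn _ _ => inferInstanceAs (Fintype Empty)

namespace Ty

noncomputable def coord : (τ : Ty) → τ.FirstOrder → τ.sem ≃ E τ.Coord
  | .real _, _ => Equiv.refl _
  | .unit, _ => unitCoord
  | .prod σ τ, h => prodCoord (σ.coord h.1) (τ.coord h.2)

noncomputable def fwd₁Coord : (τ : Ty) → τ.FirstOrder → τ.fwd₁.sem ≃ E τ.Coord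
  | .real _, _ => Equiv.refl _
  | .unit, _ => unitCoord
  | .prod σ τ, h => prodCoord (σ.fwd₁Coord h.1) (τ.fwd₁Coord h.2)

noncomputable def fwd₂Coord : (τ : Ty) → τ.FirstOrder → τ.fwd₂.sem ≃ E τ.Coord
  | .real _, _ => Equiv.refl _
  | .unit, _ => unitCoord
  | .prod σ τ, h => prodCoord (σ.fwd₂Coord h.1) (τ.fwd₂Coord h.2)

noncomputable def rev₁Coord : (τ : Ty) → τ.FirstOrder → τ.rev₁.sem ≃ E τ.Coord
  | .real _, _ => Equiv.refl _
  | .unit, _ => unitCoord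
  | .prod σ τ, h => prodCoord (σ.rev₁Coord h.1) (τ.rev₁Coord h.2)

noncomputable def rev₂Coord : (τ : Ty) → τ.FirstOrder → τ.rev₂.sem ≃ E τ.Coord
  | .real _, _ => Equiv.refl _
  | .unit, _ => unitCoord
  | .prod σ τ, h => prodCoord (σ.rev₂Coord h.1) (τ.rev₂Coord h.2)

end Ty

/-- Contexts of first-order types. -/
abbrev FirstOrderCtx (Γ : List Ty) : Prop := ∀ τ ∈ Γ, τ.FirstOrder

/-- The index set of the coordinates of a context of first-order types. -/
abbrev CtxCoord (Γ : List Ty) : Type := ListCoord Ty.Coord Γ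

noncomputable def ctxCoord {Γ : List Ty} (h : FirstOrderCtx Γ) :
    Env Ty.sem Γ ≃ E (CtxCoord Γ) :=
  Env.coord Γ fun τ hτ => τ.coord (h τ hτ)

noncomputable def fwdCtx₁Coord {Γ : List Ty} (h : FirstOrderCtx Γ) :
    Env CTy.sem (fwdCtx₁ Γ) ≃ E (CtxCoord Γ) :=
  Env.mapCoord Ty.fwd₁ Γ fun τ hτ => τ.fwd₁Coord (h τ hτ)

noncomputable def fwdCtx₂Coord {Γ : List Ty} (h : FirstOrderCtx Γ) :
    (fwdCtx₂ Γ).sem ≃ E (CtxCoord Γ) :=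
  ltupleCoord Ty.fwd₂ Γ fun τ hτ => τ.fwd₂Coord (h τ hτ)

noncomputable def revCtx₁Coord {Γ : List Ty} (h : FirstOrderCtx Γ) :
    Env CTy.sem (revCtx₁ Γ) ≃ E (CtxCoord Γ) :=
  Env.mapCoord Ty.rev₁ Γ fun τ hτ => τ.rev₁Coord (h τ hτ)

noncomputable def revCtx₂Coord {Γ : List Ty} (h : FirstOrderCtx Γ) :
    (revCtx₂ Γ).sem ≃ E (CtxCoord Γ) :=
  ltupleCoord Ty.rev₂ Γ fun τ hτ => τ.rev₂Coord (h τ hτ)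

/-- The usual derivative `x ↦ v ↦ Df(x)(v)`. -/
noncomputable def D {ι κ : Type} [Fintype ι] [Fintype κ] (f : E ι → E κ) : E ι → E ι → E κ :=
  fun x v => fderiv ℝ f x v

/-- The transposed derivative `x ↦ w ↦ Df(x)ᵗ(w)`: multiplication by the transpose of the Jacobian
matrix, that is, the adjoint of `Df(x)` with respect to the standard inner products. -/
noncomputable def Dt {ι κ : Type} [Fintype ι] [Fintype κ] (f : E ι → E κ) : E ι → E κ → E ι :=
  fun x w => ContinuousLinearMap.adjoint (fderiv ℝ f x) w

/-- The denotation of a source term between first-order types, in coordinates. -/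
noncomputable def Tm.semCoord (I : Interp S) {Γ : List Ty} {τ : Ty} (hΓ : FirstOrderCtx Γ)
    (hτ : τ.FirstOrder) (t : Tm S Γ τ) : E (CtxCoord Γ) → E τ.Coord :=
  inCoords (ctxCoord hΓ) (τ.coord hτ) (t.sem I)

/-- Pairs of a primal and a linear function on tangents, in coordinates. -/
noncomputable def fwdPairCoord {Γ : List Ty} {τ : Ty} (hΓ : FirstOrderCtx Γ) (hτ : τ.FirstOrder)
    (p : τ.fwd₁.sem × ((fwdCtx₂ Γ).sem →+ τ.fwd₂.sem)) :
    E τ.Coord × (E (CtxCoord Γ) → E τ.Coord) :=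
  (τ.fwd₁Coord hτ p.1, inCoords (fwdCtx₂Coord hΓ) (τ.fwd₂Coord hτ) p.2)

/-- Pairs of a primal and a linear function on cotangents, in coordinates. -/
noncomputable def revPairCoord {Γ : List Ty} {τ : Ty} (hΓ : FirstOrderCtx Γ) (hτ : τ.FirstOrder)
    (p : τ.rev₁.sem × (τ.rev₂.sem →+ (revCtx₂ Γ).sem)) :
    E τ.Coord × (E τ.Coord → E (CtxCoord Γ)) :=
  (τ.rev₁Coord hτ p.1, inCoords (τ.rev₂Coord hτ) (revCtx₂Coord hΓ) p.2)

/-- The derivatives of the primitive operations are implemented correctly: `⟦D op⟧ = D⟦op⟧`. -/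
def Derivs.FwdCorrect (P : Derivs S) (I : Interp S) : Prop :=
  ∀ (ns : List ℕ) (m : ℕ) (o : S.Op ns m) (x : E (ArgCoord ns)),
    inCoords (argTupleCoord ns) (Equiv.refl (Rn m)) ((P.fwd o).sem I ((argCtxCoord ns).symm x)) =
      D (inCoords (argCoord ns) (Equiv.refl (Rn m)) (I.op o)) x

/-- The transposed derivatives of the primitive operations are implemented correctly:
`⟦(D op)ᵗ⟧ = (D⟦op⟧)ᵗ`. -/
def Derivs.RevCorrect (P : Derivs S) (I : Interp S) : Prop :=
  ∀ (ns : List ℕ) (m : ℕ) (o : S.Op ns m) (x : E (ArgCoord ns)),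
    inCoords (Equiv.refl (Rn m)) (argTupleCoord ns) ((P.rev o).sem I ((argCtxCoord ns).symm x)) =
      Dt (inCoords (argCoord ns) (Equiv.refl (Rn m)) (I.op o)) x

end CHAD

open CHAD

/-!
The proof is by logical relations, one for each mode of differentiation, over *plots*: functions out
of a fixed real inner product space `U` (complete in reverse mode, so that adjoints exist).

A plot `f : U → ⟦τ⟧` is related to a plot `g` of primals and to a family `h` of tangents (or of
homomorphisms pulling cotangents back to `U`) if they are what differentiation of `f` should produce
(`FwdRel`, `RevRel`).  At `real n` this says that `f` is smooth, that `g = f` and that `h` is the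
derivative of `f`, respectively its transpose; at products it is componentwise; at function types
related arguments are to be sent to related results, where the derivative of `u ↦ f u (a u)` is the
sum of a contribution of `f` and one of `a`.  In reverse mode, the contribution of `f` is read off
from the copower at the singleton `!a ⊗ w`.

The fundamental lemmas (`FwdEnvRel.fwd`, `RevEnvRel.rev`) say that the transform of any source term
sends related environments to related values.  They go by induction on the term; additivity of the
linear functions is what makes the cases of abstraction and application work, and the chain rule
(`IsFwd.comp`, `IsRev.comp`) together with the correctness of the derivatives of the primitive
operations is the case of `op`.

At a first-order type, the relations hold exactly if, in coordinates, `f` is smooth, `g` is `f` and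
`h` is the derivative or its transpose (`fwdRel_iff_isFwd`, `revRel_iff_isRev`).  Hence the identity
plot of a first-order context, with `U` its space of coordinates, is a related environment, and the
fundamental lemma at this environment is the theorem.
-/

namespace CHAD

variable {S : Signature.{u}}

/-! ### Semantics of renaming and of the derived term formers -/

theorem Env.lookup_lift {Γ Δ : List CTy} {r : Ren Γ Δ} {ρ : Env CTy.sem Γ} {ρ' : Env CTy.sem Δ}
    (h : ∀ A (x : Var Γ A), ρ'.lookup (r A x) = ρ.lookup x) {B : CTy} (b : B.sem) :
    ∀ A (x : Var (B :: Γ) A),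
      Env.lookup (sem := CTy.sem) (l := B :: Δ) (ρ', b) (r.lift B A x) =
        Env.lookup (sem := CTy.sem) (l := B :: Γ) (ρ, b) x
  | _, .here => rfl
  | _, .there x => h _ x

mutual
theorem CTm.sem_rename (I : Interp S) {Γ Δ : List CTy} {A : CTy} :
    ∀ (t : CTm S Γ A) {r : Ren Γ Δ} {ρ : Env CTy.sem Γ} {ρ' : Env CTy.sem Δ},
      (∀ A (x : Var Γ A), ρ'.lookup (r A x) = ρ.lookup x) →
      (t.rename r).sem I ρ' = t.sem I ρ
  | .var x, _, _, _, h => h _ x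
  | .letE t s, _, _, _, h => by
    simp only [CTm.rename, CTm.sem]
    rw [t.sem_rename I h, s.sem_rename I (Env.lookup_lift h _)]
  | .op o ts, _, _, _, h => by
    simp only [CTm.rename, CTm.sem]
    congr 2
    funext n x
    exact (ts n x).sem_rename I h
  | .unit, _, _, _, _ => rfl
  | .pair t s, _, _, _, h => by
    simp only [CTm.rename, CTm.sem]
    rw [t.sem_rename I h, s.sem_rename I h]
  | .fst t, _, _, _, h => by
    simp only [CTm.rename, CTm.sem]
    rw [t.sem_rename I h]
  | .snd t, _, _, _, h => by
    simp only [CTm.rename, CTm.sem]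
    rw [t.sem_rename I h]
  | .lam t, _, _, _, h => by
    simp only [CTm.rename, CTm.sem]
    funext a
    exact t.sem_rename I (Env.lookup_lift h a)
  | .app t s, _, _, _, h => by
    simp only [CTm.rename, CTm.sem]
    rw [t.sem_rename I h, s.sem_rename I h]
  | .llam t, _, _, _, h => by
    simp only [CTm.rename, CTm.sem]
    exact t.sem_rename I h
theorem LTm.sem_rename (I : Interp S) {Γ Δ : List CTy} {L M : LTy} :
    ∀ (t : LTm S Γ L M) {r : Ren Γ Δ} {ρ : Env CTy.sem Γ} {ρ' : Env CTy.sem Δ},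
      (∀ A (x : Var Γ A), ρ'.lookup (r A x) = ρ.lookup x) →
      (t.rename r).sem I ρ' = t.sem I ρ
  | .lvar, _, _, _, _ => rfl
  | .letC t s, _, _, _, h => by
    simp only [LTm.rename, LTm.sem]
    rw [t.sem_rename I h, s.sem_rename I (Env.lookup_lift h _)]
  | .letL t s, _, _, _, h => by
    simp only [LTm.rename, LTm.sem]
    rw [t.sem_rename I h, s.sem_rename I h]
  | .lop o ts s, _, _, _, h => by
    simp only [LTm.rename, LTm.sem]
    rw [s.sem_rename I h]
    congr 3
    funext n x
    exact (ts n x).sem_rename I h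
  | .unit, _, _, _, _ => rfl
  | .pair t s, _, _, _, h => by
    simp only [LTm.rename, LTm.sem]
    rw [t.sem_rename I h, s.sem_rename I h]
  | .fst t, _, _, _, h => by
    simp only [LTm.rename, LTm.sem]
    rw [t.sem_rename I h]
  | .snd t, _, _, _, h => by
    simp only [LTm.rename, LTm.sem]
    rw [t.sem_rename I h]
  | .lam t, _, _, _, h => by
    simp only [LTm.rename, LTm.sem]
    congr 1
    funext a
    exact t.sem_rename I (Env.lookup_lift h a)
  | .app t s, _, _, _, h => by
    simp only [LTm.rename, LTm.sem]
    rw [t.sem_rename I h, s.sem_rename I h]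
  | .copow t s, _, _, _, h => by
    simp only [LTm.rename, LTm.sem]
    rw [t.sem_rename I h, s.sem_rename I h]
  | .copowE t s, _, _, _, h => by
    simp only [LTm.rename, LTm.sem]
    rw [t.sem_rename I h]
    congr 2
    funext a
    exact s.sem_rename I (Env.lookup_lift h a)
  | .lapp t s, _, _, _, h => by
    simp only [LTm.rename, LTm.sem]
    rw [t.sem_rename I h, s.sem_rename I h]
  | .zero, _, _, _, _ => rfl
  | .add t s, _, _, _, h => by
    simp only [LTm.rename, LTm.sem]
    rw [t.sem_rename I h, s.sem_rename I h]
end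

/-- Extension of an environment by an entry: a pair, but with the type of environments, so that
lemmas on denotations rewrite under it. -/
def Env.snoc {α : Type} {sem : α → Type} {l : List α} {a : α} (ρ : Env sem l) (b : sem a) :
    Env sem (a :: l) :=
  (ρ, b)

theorem CTm.sem_wk (I : Interp S) {Γ : List CTy} {A B : CTy} (t : CTm S Γ A)
    (ρ : Env CTy.sem Γ) (b : B.sem) :
    (t.wk (B := B)).sem I (ρ.snoc b) = t.sem I ρ :=
  t.sem_rename I fun _ _ => rfl

theorem sem_plet (I : Interp S) {Γ : List CTy} {A B C : CTy} (t : CTm S Γ (.prod A B))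
    (s : CTm S (B :: A :: Γ) C) (ρ : Env CTy.sem Γ) :
    (plet t s).sem I ρ =
      s.sem I ((ρ.snoc (Prod.fst (t.sem I ρ))).snoc (Prod.snd (t.sem I ρ))) :=
  s.sem_rename I <| Env.lookup_lift (Env.lookup_lift (Γ := Γ) (Δ := .prod A B :: Γ) (ρ := ρ)
    (ρ' := (ρ, t.sem I ρ)) (r := fun _ x => .there x) (fun _ _ => rfl) _) _

/-- The iterated tuple `let` denotes `b` if its body does so in every environment in which the
identifiers `x₁, …, xₖ` and `x₁', …, xₖ'` hold the components of the pairs. -/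
theorem sem_pletMany (I : Interp S) {B : CTy} {F : ℕ → CTy} {Γ : List CTy} (ρ : Env CTy.sem Γ)
    (b : B.sem) : ∀ (ns : List ℕ) (ts : ∀ n, Var ns n → CTm S Γ (.prod (.real n) (F n)))
      (body : ∀ Δ : List CTy, Ren Γ Δ → (∀ n, Var ns n → Var Δ (.real n)) →
        (∀ n, Var ns n → Var Δ (F n)) → CTm S Δ B),
      (∀ (Δ : List CTy) (r : Ren Γ Δ) (xs : ∀ n, Var ns n → Var Δ (.real n))
        (xs' : ∀ n, Var ns n → Var Δ (F n)) (ρ' : Env CTy.sem Δ),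
        (∀ A (x : Var Γ A), ρ'.lookup (r A x) = ρ.lookup x) →
        (∀ n x, ρ'.lookup (xs n x) = Prod.fst ((ts n x).sem I ρ)) →
        (∀ n x, ρ'.lookup (xs' n x) = Prod.snd ((ts n x).sem I ρ)) →
        (body Δ r xs xs').sem I ρ' = b) →
      (pletMany F ns ts body).sem I ρ = b
  | [], _, _, h => h _ _ _ _ ρ (fun _ _ => rfl) (fun _ x => nomatch x) (fun _ x => nomatch x)
  | n :: ns, ts, body, h => by
    refine sem_pletMany I ρ b ns _ _ fun Δ r xs xs' ρ' hr hx hx' => ?_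
    rw [sem_plet, (ts n .here).sem_rename I hr]
    refine h _ _ _ _ _ hr ?_ ?_
    · rintro _ (_ | x)
      · rfl
      · exact hx _ x
    · rintro _ (_ | x)
      · rfl
      · exact hx' _ x

/-- The environment of the identifiers `x₁ : real n₁, …, xₖ : real nₖ` with given values. -/
noncomputable def argEnv : {ns : List ℕ} → (∀ n, Var ns n → Rn n) →
    Env CTy.sem (ns.map CTy.real)
  | [], _ => PUnit.unit
  | _ :: _, g => (argEnv fun n x => g n (.there x), g _ .here)

/-- Reading an environment through `argRen xs` gives the environment of the values of the `xs`. -/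
theorem lookup_argRen {Δ : List CTy} (ρ : Env CTy.sem Δ) {A : CTy} :
    ∀ {ns : List ℕ} (xs : ∀ n, Var ns n → Var Δ (.real n)) (x : Var (ns.map CTy.real) A),
      ρ.lookup (argRen xs A x) = (argEnv fun n y => (ρ.lookup (xs n y) : Rn n)).lookup x
  | _ :: _, _, .here => rfl
  | _ :: _, xs, .there x => lookup_argRen ρ (fun n y => xs n (.there y)) x

/-- An element of `⟦L ⊸ M⟧`, as a monoid homomorphism. -/
noncomputable abbrev CTy.linear {L M : LTy} (f : (CTy.lfn L M).sem) : L.sem →+ M.sem := f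

theorem CTy.linear_inl_add_inr {L M N : LTy} (f : (CTy.lfn (.prod L M) N).sem) (a : L.sem)
    (b : M.sem) : CTy.linear f (a, 0) + CTy.linear f (0, b) = CTy.linear f (a, b) :=
  ((CTy.linear f).map_add (a, 0) (0, b)).symm.trans
    (congrArg _ (Prod.ext (add_zero a) (zero_add b)))

/-- The linear tuple with the given entries. -/
def ltupleMk {α : Type} {f : α → LTy} : {l : List α} → (∀ a, Var l a → (f a).sem) →
    (ltuple f l).sem
  | [], _ => PUnit.unit
  | _ :: _, g => (ltupleMk fun a x => g a (.there x), g _ .here)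

/-- An entry of a linear tuple. -/
def ltupleGet {α : Type} {f : α → LTy} : {l : List α} → {a : α} → Var l a → (ltuple f l).sem →
    (f a).sem
  | _, _, .here, w => w.2
  | _, _, .there x, w => ltupleGet x w.1

/-- The linear tuple whose only nonzero entry is the given one. -/
noncomputable def ltupleSingle {α : Type} {f : α → LTy} : {l : List α} → {a : α} → Var l a →
    (f a).sem → (ltuple f l).sem
  | _, _, .here, w => (0, w)
  | _, _, .there x, w => (ltupleSingle x w, 0)

/-- The homomorphism out of a linear tuple type given by homomorphisms out of its entries. -/
noncomputable def ltupleLift {α : Type} {f : α → LTy} {N : Type} [AddCommMonoid N] :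
    {l : List α} → (∀ a, Var l a → ((f a).sem →+ N)) → ((ltuple f l).sem →+ N)
  | [], _ => 0
  | _ :: _, g => AddMonoidHom.coprod (ltupleLift fun a x => g a (.there x)) (g _ .here)

theorem LTm.sem_tuple (I : Interp S) {α : Type} {f : α → LTy} {Γ : List CTy} {L : LTy}
    (ρ : Env CTy.sem Γ) (w : L.sem) :
    ∀ {l : List α} (ts : ∀ a, Var l a → LTm S Γ L (f a)),
      (LTm.tuple ts).sem I ρ w = ltupleMk fun a x => (ts a x).sem I ρ w
  | [], _ => rfl
  | _ :: _, ts => Prod.ext (sem_tuple I ρ w fun a x => ts a (.there x)) rfl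

theorem LTm.sem_proj (I : Interp S) {α : Type} {f : α → LTy} {Γ : List CTy} {L : LTy}
    (ρ : Env CTy.sem Γ) (w : L.sem) : ∀ {l : List α} {a : α} (x : Var l a)
      (t : LTm S Γ L (ltuple f l)), (LTm.proj x t).sem I ρ w = ltupleGet x (t.sem I ρ w)
  | _, _, .here, _ => rfl
  | _, _, .there x, t => sem_proj I ρ w x (.fst t)

/-- The sum of linear functions of the entries of a tuple, as it occurs in the reverse transform of
an operation, is their joint lift to the tuple type. -/
theorem LTm.sem_sum_proj (I : Interp S) {α : Type} {f : α → LTy} {Γ : List CTy} {L M : LTy}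
    {N : Type} [AddCommMonoid N] (φ : M.sem →+ N) (ρ : Env CTy.sem Γ) (w : L.sem) :
    ∀ {l : List α} (ts : ∀ a, Var l a → CTm S Γ (.lfn (f a) M)) (s : LTm S Γ L (ltuple f l)),
      φ ((LTm.sum fun a x => LTm.lapp (ts a x) (LTm.proj x s)).sem I ρ w) =
        ltupleLift (fun a x => φ.comp (CTy.linear ((ts a x).sem I ρ))) (s.sem I ρ w)
  | [], _, _ => map_zero φ
  | _ :: _, ts, s => (map_add φ _ _).trans <|
      congrArg (· + _) (sem_sum_proj I φ ρ w (fun a x => ts a (.there x)) (.fst s))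

theorem LTm.sem_coproj (I : Interp S) {α : Type} {f : α → LTy} {Γ : List CTy} {L : LTy}
    (ρ : Env CTy.sem Γ) (w : L.sem) : ∀ {l : List α} {a : α} (x : Var l a)
      (t : LTm S Γ L (f a)), (LTm.coproj x t).sem I ρ w = ltupleSingle x (t.sem I ρ w)
  | _, _, .here, _ => rfl
  | _, _, .there x, t => Prod.ext (sem_coproj I ρ w x t) rfl

/-! ### Derivatives and their transposes in coordinates -/

section Coordinates

open scoped InnerProductSpace

variable {U : Type} [NormedAddCommGroup U] [InnerProductSpace ℝ U]
variable {A A₁ A₂ B B₁ B₂ ι κ : Type} [Fintype ι] [Fintype κ]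

/-- `g` and `h` compute the primals and the tangents of the smooth plot `f : U → A`, in the
coordinates `e`, `e₁`, `e₂`.  The coordinates are bare bijections: the smooth structure on
`A` is the one they transport. -/
def IsFwd (e : A ≃ E ι) (e₁ : A₁ ≃ E ι) (e₂ : A₂ ≃ E ι)
    (f : U → A) (g : U → A₁) (h : U → U → A₂) : Prop :=
  ContDiff ℝ ∞ (fun u => e (f u)) ∧ (∀ u, e₁ (g u) = e (f u)) ∧
    ∀ u v, e₂ (h u v) = fderiv ℝ (fun u => e (f u)) u v

/-- `g` and `h` compute the primals and the transposed derivatives of the smooth plot `f : U → A`,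
in the coordinates `e`, `e₁`, `e₂`. -/
def IsRev [CompleteSpace U] (e : A ≃ E ι) (e₁ : A₁ ≃ E ι) (e₂ : A₂ ≃ E ι)
    (f : U → A) (g : U → A₁) (h : U → A₂ → U) : Prop :=
  ContDiff ℝ ∞ (fun u => e (f u)) ∧ (∀ u, e₁ (g u) = e (f u)) ∧
    ∀ u w, h u w = ContinuousLinearMap.adjoint (fderiv ℝ (fun u => e (f u)) u) (e₂ w)

theorem prodCoord_apply (eA : A ≃ E ι) (eB : B ≃ E κ) (p : A × B) :
    prodCoord eA eB p =
      (EuclideanSpace.sumEquivProd (𝕜 := ℝ) (ι := ι) (κ := κ)).symm (eA p.1, eB p.2) :=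
  rfl

theorem prodCoord_eq_iff {eA : A ≃ E ι} {eB : B ≃ E κ} {p : A × B} {x : E ι} {y : E κ} :
    prodCoord eA eB p = (EuclideanSpace.sumEquivProd (𝕜 := ℝ) (ι := ι) (κ := κ)).symm (x, y) ↔
      eA p.1 = x ∧ eB p.2 = y := by
  rw [prodCoord_apply, EmbeddingLike.apply_eq_iff_eq, Prod.mk.injEq]

theorem contDiff_prodCoord {eA : A ≃ E ι} {eB : B ≃ E κ} {f : U → A × B} :
    ContDiff ℝ ∞ (fun u => prodCoord eA eB (f u)) ↔
      ContDiff ℝ ∞ (fun u => eA (f u).1) ∧ ContDiff ℝ ∞ (fun u => eB (f u).2) := by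
  have h : (fun u => prodCoord eA eB (f u)) =
      (EuclideanSpace.sumEquivProd (𝕜 := ℝ) (ι := ι) (κ := κ)).symm ∘
        fun u => (eA (f u).1, eB (f u).2) := rfl
  rw [h, ContinuousLinearEquiv.comp_contDiff_iff]
  exact ⟨fun h => ⟨h.fst, h.snd⟩, fun h => h.1.prodMk h.2⟩

theorem fderiv_prodCoord {eA : A ≃ E ι} {eB : B ≃ E κ} {f : U → A × B}
    (hf : ContDiff ℝ ∞ (fun u => prodCoord eA eB (f u))) (u v : U) :
    fderiv ℝ (fun u => prodCoord eA eB (f u)) u v =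
      (EuclideanSpace.sumEquivProd (𝕜 := ℝ) (ι := ι) (κ := κ)).symm
        (fderiv ℝ (fun u => eA (f u).1) u v, fderiv ℝ (fun u => eB (f u).2) u v) := by
  have h : (fun u => prodCoord eA eB (f u)) =
      (EuclideanSpace.sumEquivProd (𝕜 := ℝ) (ι := ι) (κ := κ)).symm ∘
        fun u => (eA (f u).1, eB (f u).2) := rfl
  obtain ⟨h₁, h₂⟩ := contDiff_prodCoord.1 hf
  rw [h, ContinuousLinearEquiv.comp_fderiv,
    DifferentiableAt.fderiv_prodMk (h₁.differentiable (by simp) u) (h₂.differentiable (by simp) u)]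
  rfl

theorem inner_sumEquivProd_symm (a c : E ι) (b d : E κ) :
    ⟪(EuclideanSpace.sumEquivProd (𝕜 := ℝ) (ι := ι) (κ := κ)).symm (a, b),
      (EuclideanSpace.sumEquivProd (𝕜 := ℝ) (ι := ι) (κ := κ)).symm (c, d)⟫_ℝ =
      ⟪a, c⟫_ℝ + ⟪b, d⟫_ℝ := by
  simp [PiLp.inner_apply, EuclideanSpace.sumEquivProd]

/-- The transposed derivative of a pair is the sum of the transposed derivatives of its components,
since the inner product of the concatenation is the sum of the inner products. -/
theorem adjoint_fderiv_prodCoord [CompleteSpace U] {eA : A ≃ E ι} {eB : B ≃ E κ} {f : U → A × B}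
    (hf : ContDiff ℝ ∞ (fun u => prodCoord eA eB (f u))) (u : U) (a : E ι) (b : E κ) :
    ContinuousLinearMap.adjoint (fderiv ℝ (fun u => prodCoord eA eB (f u)) u)
        ((EuclideanSpace.sumEquivProd (𝕜 := ℝ) (ι := ι) (κ := κ)).symm (a, b)) =
      ContinuousLinearMap.adjoint (fderiv ℝ (fun u => eA (f u).1) u) a +
        ContinuousLinearMap.adjoint (fderiv ℝ (fun u => eB (f u).2) u) b := by
  refine ext_inner_right ℝ fun v => ?_
  rw [ContinuousLinearMap.adjoint_inner_left, fderiv_prodCoord hf, inner_sumEquivProd_symm,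
    inner_add_left, ContinuousLinearMap.adjoint_inner_left,
    ContinuousLinearMap.adjoint_inner_left]

theorem isFwd_unit {f : U → PUnit} {g : U → PUnit} {h : U → U → PUnit} :
    IsFwd unitCoord unitCoord unitCoord f g h :=
  ⟨contDiff_const, fun _ => rfl, fun _ _ => Subsingleton.elim _ _⟩

theorem isRev_unit [CompleteSpace U] {f : U → PUnit} {g : U → PUnit} {h : U → PUnit → U} :
    IsRev unitCoord unitCoord unitCoord f g h ↔ ∀ u w, h u w = 0 := by
  have h₀ (u : U) (w : PUnit) : ContinuousLinearMap.adjoint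
      (fderiv ℝ (fun u => unitCoord (f u)) u) (unitCoord w) = 0 := by
    rw [show unitCoord w = 0 from rfl, map_zero]
  exact ⟨fun H u w => (H.2.2 u w).trans (h₀ u w),
    fun H => ⟨contDiff_const, fun _ => rfl, fun u w => (H u w).trans (h₀ u w).symm⟩⟩

theorem isFwd_prod {eA : A ≃ E ι} {eA₁ : A₁ ≃ E ι} {eA₂ : A₂ ≃ E ι} {eB : B ≃ E κ}
    {eB₁ : B₁ ≃ E κ} {eB₂ : B₂ ≃ E κ} {f : U → A × B} {g : U → A₁ × B₁} {h : U → U → A₂ × B₂} :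
    IsFwd (prodCoord eA eB) (prodCoord eA₁ eB₁) (prodCoord eA₂ eB₂) f g h ↔
      IsFwd eA eA₁ eA₂ (fun u => (f u).1) (fun u => (g u).1) (fun u v => (h u v).1) ∧
      IsFwd eB eB₁ eB₂ (fun u => (f u).2) (fun u => (g u).2) (fun u v => (h u v).2) := by
  constructor
  · rintro ⟨H, H₁, H₂⟩
    have K₁ u := prodCoord_eq_iff.1 (H₁ u)
    have K₂ u v := prodCoord_eq_iff.1 ((H₂ u v).trans (fderiv_prodCoord H u v))
    have K := contDiff_prodCoord.1 H
    exact ⟨⟨K.1, fun u => (K₁ u).1, fun u v => (K₂ u v).1⟩,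
      ⟨K.2, fun u => (K₁ u).2, fun u v => (K₂ u v).2⟩⟩
  · rintro ⟨⟨H, H₁, H₂⟩, ⟨K, K₁, K₂⟩⟩
    have C := contDiff_prodCoord.2 ⟨H, K⟩
    exact ⟨C, fun u => prodCoord_eq_iff.2 ⟨H₁ u, K₁ u⟩, fun u v =>
      (prodCoord_eq_iff.2 ⟨H₂ u v, K₂ u v⟩).trans (fderiv_prodCoord C u v).symm⟩

theorem isRev_prod [CompleteSpace U] [AddZeroClass A₂] [AddZeroClass B₂] {eA : A ≃ E ι}
    {eA₁ : A₁ ≃ E ι} {eA₂ : A₂ ≃ E ι} {eB : B ≃ E κ} {eB₁ : B₁ ≃ E κ} {eB₂ : B₂ ≃ E κ}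
    (hA : eA₂ 0 = 0) (hB : eB₂ 0 = 0) {f : U → A × B} {g : U → A₁ × B₁} {h : U → (A₂ × B₂ →+ U)} :
    IsRev (prodCoord eA eB) (prodCoord eA₁ eB₁) (prodCoord eA₂ eB₂) f g (fun u => h u) ↔
      IsRev eA eA₁ eA₂ (fun u => (f u).1) (fun u => (g u).1) (fun u w => h u (w, 0)) ∧
      IsRev eB eB₁ eB₂ (fun u => (f u).2) (fun u => (g u).2) (fun u w => h u (0, w)) := by
  constructor
  · rintro ⟨H, H₁, H₂⟩
    have K₁ u := prodCoord_eq_iff.1 (H₁ u)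
    have K₂ u w w' := (H₂ u (w, w')).trans (adjoint_fderiv_prodCoord H u (eA₂ w) (eB₂ w'))
    have K := contDiff_prodCoord.1 H
    refine ⟨⟨K.1, fun u => (K₁ u).1, fun u w => (K₂ u w 0).trans ?_⟩,
      ⟨K.2, fun u => (K₁ u).2, fun u w => (K₂ u 0 w).trans ?_⟩⟩
    · rw [hB, map_zero, add_zero]
    · rw [hA, map_zero, zero_add]
  · rintro ⟨⟨H, H₁, H₂⟩, ⟨K, K₁, K₂⟩⟩
    have C := contDiff_prodCoord.2 ⟨H, K⟩
    refine ⟨C, fun u => prodCoord_eq_iff.2 ⟨H₁ u, K₁ u⟩, fun u w => ?_⟩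
    refine Eq.trans ?_ (adjoint_fderiv_prodCoord C u (eA₂ w.1) (eB₂ w.2)).symm
    rw [← H₂, ← K₂, ← map_add, Prod.mk_add_mk, add_zero, zero_add]

/-- Chain rule. -/
theorem IsFwd.comp {C C₁ C₂ ν : Type} [Fintype ν] {e : A ≃ E ι} {e₁ : A₁ ≃ E ι}
    {e₂ : A₂ ≃ E ι} {f : U → A} {g : U → A₁} {h : U → U → A₂} (H : IsFwd e e₁ e₂ f g h)
    {d : C ≃ E ν} {d₁ : C₁ ≃ E ν} {d₂ : C₂ ≃ E ν} {p : A → C}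
    (hp : ContDiff ℝ ∞ (inCoords e d p)) {g' : U → C₁}
    (hg' : ∀ u, d₁ (g' u) = d (p (f u))) {p₂ : A₁ → A₂ → C₂}
    (hp₂ : ∀ x, inCoords e₂ d₂ (p₂ (e₁.symm x)) = D (inCoords e d p) x) :
    IsFwd d d₁ d₂ (fun u => p (f u)) g' (fun u v => p₂ (g u) (h u v)) := by
  have h₀ : (fun u => d (p (f u))) = inCoords e d p ∘ fun u => e (f u) := by
    funext u
    simp [inCoords]
  refine ⟨h₀ ▸ hp.comp H.1, hg', fun u v => ?_⟩
  have := congrFun (hp₂ (e₁ (g u))) (e₂ (h u v))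
  simp only [inCoords, Equiv.symm_apply_apply] at this
  rw [this, h₀, fderiv_comp u (hp.differentiable (by simp) _) (H.1.differentiable (by simp) u),
    H.2.1, H.2.2]
  rfl

theorem IsRev.congr [CompleteSpace U] {e : A ≃ E ι} {e₁ : A₁ ≃ E ι} {e₂ : A₂ ≃ E ι}
    {f : U → A} {g : U → A₁} {h h' : U → A₂ → U} (H : IsRev e e₁ e₂ f g h)
    (hh : ∀ u w, h' u w = h u w) : IsRev e e₁ e₂ f g h' := by
  rwa [funext₂ hh]

/-- Transposed chain rule. -/
theorem IsRev.comp [CompleteSpace U] {C C₁ C₂ ν : Type} [Fintype ν] {e : A ≃ E ι} {e₁ : A₁ ≃ E ι}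
    {e₂ : A₂ ≃ E ι} {f : U → A} {g : U → A₁} {h : U → A₂ → U} (H : IsRev e e₁ e₂ f g h)
    {d : C ≃ E ν} {d₁ : C₁ ≃ E ν} {d₂ : C₂ ≃ E ν} {p : A → C}
    (hp : ContDiff ℝ ∞ (inCoords e d p)) {g' : U → C₁}
    (hg' : ∀ u, d₁ (g' u) = d (p (f u))) {p₂ : A₁ → C₂ → A₂}
    (hp₂ : ∀ x, inCoords d₂ e₂ (p₂ (e₁.symm x)) = Dt (inCoords e d p) x) :
    IsRev d d₁ d₂ (fun u => p (f u)) g' (fun u w => h u (p₂ (g u) w)) := by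
  have h₀ : (fun u => d (p (f u))) = inCoords e d p ∘ fun u => e (f u) := by
    funext u
    simp [inCoords]
  refine ⟨h₀ ▸ hp.comp H.1, hg', fun u w => ?_⟩
  have := congrFun (hp₂ (e₁ (g u))) (d₂ w)
  simp only [inCoords, Equiv.symm_apply_apply] at this
  refine (H.2.2 _ _).trans ?_
  rw [this, h₀, fderiv_comp u (hp.differentiable (by simp) _)
    (H.1.differentiable (by simp) u), ContinuousLinearMap.adjoint_comp, H.2.1]
  rfl

end Coordinates

/-! ### Forward mode: the logical relation and its fundamental lemma -/

section Forward

variable {U : Type} [NormedAddCommGroup U] [InnerProductSpace ℝ U]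

/-- The logical relation for forward mode: the plots `g` of primals and `h` of tangents, the latter
taking a point of `U` and a tangent vector at that point, are correct for the plot `f`.  At a
function type, the tangent of `u ↦ f u (a u)` is the tangent of `f` at the fixed argument plus the
derivative of the fixed function applied to the tangent of `a`. -/
def FwdRel : (τ : Ty) → (U → τ.sem) → (U → τ.fwd₁.sem) → (U → U → τ.fwd₂.sem) → Prop
  | .real n, f, g, h => IsFwd (Equiv.refl (Rn n)) (Equiv.refl (Rn n)) (Equiv.refl (Rn n)) f g h
  | .unit, _, _, _ => True
  | .prod σ τ, f, g, h =>
    FwdRel σ (fun u => (f u).1) (fun u => (g u).1) (fun u v => (h u v).1) ∧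
    FwdRel τ (fun u => (f u).2) (fun u => (g u).2) (fun u v => (h u v).2)
  | .fn σ τ, f, g, h => ∀ a a₁ a₂, FwdRel σ a a₁ a₂ →
    FwdRel τ (fun u => f u (a u)) (fun u => (g u (a₁ u)).1)
      (fun u v => (h u v : σ.fwd₁.sem → τ.fwd₂.sem) (a₁ u) +
        CTy.linear (g u (a₁ u)).2 (a₂ u v))

/-- The forward-mode logical relation on environments, entry by entry. -/
def FwdEnvRel : (Γ : List Ty) → (U → Env Ty.sem Γ) → (U → Env CTy.sem (fwdCtx₁ Γ)) →
    (U → U → (fwdCtx₂ Γ).sem) → Prop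
  | [], _, _, _ => True
  | τ :: Γ, f, g, h =>
    FwdEnvRel Γ (fun u => (f u).1) (fun u => (g u).1) (fun u v => (h u v).1) ∧
    FwdRel τ (fun u => (f u).2) (fun u => (g u).2) (fun u v => (h u v).2)

theorem fwdRel_iff_isFwd : ∀ {τ : Ty} (hτ : τ.FirstOrder) {f : U → τ.sem} {g : U → τ.fwd₁.sem}
    {h : U → U → τ.fwd₂.sem},
    FwdRel τ f g h ↔ IsFwd (τ.coord hτ) (τ.fwd₁Coord hτ) (τ.fwd₂Coord hτ) f g h
  | .real _, _, _, _, _ => Iff.rfl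
  | .unit, _, _, _, _ => iff_of_true trivial isFwd_unit
  | .prod _ _, hτ, _, _, _ =>
    (and_congr (fwdRel_iff_isFwd hτ.1) (fwdRel_iff_isFwd hτ.2)).trans isFwd_prod.symm

theorem fwdEnvRel_of_isFwd : ∀ {Γ : List Ty} (hΓ : FirstOrderCtx Γ) {f : U → Env Ty.sem Γ}
    {g : U → Env CTy.sem (fwdCtx₁ Γ)} {h : U → U → (fwdCtx₂ Γ).sem},
    IsFwd (ctxCoord hΓ) (fwdCtx₁Coord hΓ) (fwdCtx₂Coord hΓ) f g h → FwdEnvRel Γ f g h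
  | [], _, _, _, _, _ => trivial
  | _ :: _, hΓ, _, _, _, H =>
    have H := isFwd_prod.1 H
    ⟨fwdEnvRel_of_isFwd (fun τ hτ => hΓ τ (List.mem_cons_of_mem _ hτ)) H.1,
      (fwdRel_iff_isFwd (hΓ _ List.mem_cons_self)).2 H.2⟩

/-- A tuple of related plots of real arrays is a smooth plot of argument lists, with its derivative
computed entry by entry. -/
theorem isFwd_args : ∀ {ns : List ℕ} {f : ∀ n, Var ns n → U → Rn n} {g : ∀ n, Var ns n → U → Rn n}
    {h : ∀ n, Var ns n → U → U → Rn n},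
    (∀ n x, FwdRel (.real n) (f n x) (g n x) (h n x)) →
    IsFwd (argCoord ns) (argCtxCoord ns) (argTupleCoord ns)
      (fun u => Env.ofFun fun n x => f n x u) (fun u => argEnv fun n x => g n x u)
      (fun u v => ltupleMk (f := LTy.real) fun n x => h n x u v)
  | [], _, _, _, _ => isFwd_unit
  | _ :: _, _, _, _, H => isFwd_prod.2 ⟨isFwd_args fun n x => H n (.there x), H _ .here⟩

theorem FwdRel.congr {τ : Ty} {f f' : U → τ.sem} {g g' : U → τ.fwd₁.sem} {h h' : U → U → τ.fwd₂.sem}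
    (H : FwdRel τ f g h) (hf : ∀ u, f' u = f u) (hg : ∀ u, g' u = g u)
    (hh : ∀ u v, h' u v = h u v) : FwdRel τ f' g' h' := by
  rwa [funext hf, funext hg, funext₂ hh]

theorem FwdEnvRel.lookup : ∀ {Γ : List Ty} {τ : Ty} (x : Var Γ τ) {ρ : U → Env Ty.sem Γ}
    {ρ₁ : U → Env CTy.sem (fwdCtx₁ Γ)} {ρ₂ : U → U → (fwdCtx₂ Γ).sem}, FwdEnvRel Γ ρ ρ₁ ρ₂ →
    FwdRel τ (fun u => (ρ u).lookup x) (fun u => (ρ₁ u).lookup (x.map Ty.fwd₁))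
      (fun u v => ltupleGet x (ρ₂ u v))
  | _, _, .here, _, _, _, H => H.2
  | _, _, .there x, _, _, _, H => FwdEnvRel.lookup x H.1

/-- The denotation of the forward transform of `op(t₁, …, tₖ)`, without the tuple `let`s. -/
theorem Tm.sem_fwd_op (I : Interp S) (P : Derivs S) {Γ : List Ty} {ns : List ℕ} {m : ℕ}
    (o : S.Op ns m) (ts : ∀ n, Var ns n → Tm S Γ (.real n)) (ρ : Env CTy.sem (fwdCtx₁ Γ)) :
    ((Tm.op o ts).fwd P).sem I ρ =
      (I.op o (Env.ofFun fun n x => Prod.fst (((ts n x).fwd P).sem I ρ)),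
        ((P.fwd o).sem I (argEnv fun n x => Prod.fst (((ts n x).fwd P).sem I ρ))).comp
          ((LTm.tuple (f := LTy.real) fun n (x : Var ns n) =>
            LTm.lapp (.snd ((ts n x).fwd P)) .lvar).sem I ρ)) := by
  refine sem_pletMany I ρ _ ns _ _ fun Δ r xs xs' ρ' _ hx hx' => Prod.ext ?_ ?_
  · exact congrArg (I.op o) (congrArg Env.ofFun (funext₂ hx))
  · refine AddMonoidHom.ext fun v => ?_
    change ((P.fwd o).rename (argRen xs)).sem I ρ' ((LTm.tuple (f := LTy.real) fun n x =>
      LTm.lapp (.var (xs' n x)) .lvar).sem I ρ' v) = (P.fwd o).sem I _ (LTm.sem I _ ρ v)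
    rw [LTm.sem_rename I _ fun _ => lookup_argRen ρ' xs, LTm.sem_tuple, LTm.sem_tuple]
    congr 1
    · exact congrArg (fun e => (P.fwd o).sem I (argEnv e)) (funext₂ hx)
    · refine congrArg ltupleMk (funext₂ fun n x => ?_)
      exact congrArg (fun φ => CTy.linear φ v) (hx' n x)

/-- The fundamental lemma of the forward-mode logical relation: the transform of a source term sends
related environments to related values. -/
theorem FwdEnvRel.fwd (I : Interp S) (P : Derivs S) (hP : P.FwdCorrect I) {Γ : List Ty} {τ : Ty}
    (t : Tm S Γ τ) : ∀ {ρ : U → Env Ty.sem Γ}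
    {ρ₁ : U → Env CTy.sem (fwdCtx₁ Γ)} {ρ₂ : U → U → (fwdCtx₂ Γ).sem}, FwdEnvRel Γ ρ ρ₁ ρ₂ →
    FwdRel τ (fun u => t.sem I (ρ u)) (fun u => Prod.fst ((t.fwd P).sem I (ρ₁ u)))
      (fun u v => CTy.linear (Prod.snd ((t.fwd P).sem I (ρ₁ u))) (ρ₂ u v)) := by
  induction t with
  | var x =>
    intro ρ ρ₁ ρ₂ H
    exact (H.lookup x).congr (fun _ => rfl) (fun _ => rfl) fun u v =>
      LTm.sem_proj I (ρ₁ u) (ρ₂ u v) x .lvar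
  | letE t s iht ihs =>
    intro ρ ρ₁ ρ₂ H
    have h := ihs (ρ := fun u => (ρ u, t.sem I (ρ u)))
      (ρ₁ := fun u => (ρ₁ u, Prod.fst ((t.fwd P).sem I (ρ₁ u))))
      (ρ₂ := fun u v => (ρ₂ u v, CTy.linear (Prod.snd ((t.fwd P).sem I (ρ₁ u))) (ρ₂ u v)))
      ⟨H, iht H⟩
    simp only [Tm.fwd, sem_plet, CTm.sem_wk]
    exact h
  | op o ts ih =>
    intro ρ ρ₁ ρ₂ H
    refine FwdRel.congr (τ := .real _)
      ((isFwd_args fun n x => ih n x H).comp (d₁ := Equiv.refl _)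
        (p₂ := fun x => (P.fwd o).sem I x) (I.op_smooth o)
        (fun u => congrArg (I.op o) (congrArg Env.ofFun (funext₂ fun n x => (ih n x H).2.1 u)))
        (hP _ _ o))
      (fun _ => rfl) (fun u => ?_) (fun u v => ?_)
    · exact congrArg Prod.fst (Tm.sem_fwd_op I P o ts (ρ₁ u))
    · rw [Tm.sem_fwd_op]
      exact congrArg _ (LTm.sem_tuple I _ _ _)
  | unit => exact fun _ => trivial
  | pair t s iht ihs =>
    intro ρ ρ₁ ρ₂ H
    simp only [Tm.fwd, sem_plet, CTm.sem_wk]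
    exact ⟨iht H, ihs H⟩
  | fst t iht =>
    intro ρ ρ₁ ρ₂ H
    simp only [Tm.fwd, sem_plet]
    exact (iht H).1
  | snd t iht =>
    intro ρ ρ₁ ρ₂ H
    simp only [Tm.fwd, sem_plet]
    exact (iht H).2
  | lam t ih =>
    intro ρ ρ₁ ρ₂ H a a₁ a₂ ha
    have h := ih (ρ := fun u => (ρ u, a u)) (ρ₁ := fun u => (ρ₁ u, a₁ u))
      (ρ₂ := fun u v => (ρ₂ u v, a₂ u v)) ⟨H, ha⟩
    refine h.congr (fun _ => rfl) (fun _ => rfl) (fun u v => ?_)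
    -- The body is linear in the tangents of the context and of the argument jointly.
    exact CTy.linear_inl_add_inr (Prod.snd ((t.fwd P).sem I (ρ₁ u, a₁ u))) (ρ₂ u v) (a₂ u v)
  | app t s iht ihs =>
    intro ρ ρ₁ ρ₂ H
    have h := iht H _ _ _ (ihs H)
    simp only [Tm.fwd, sem_plet, CTm.sem_wk]
    exact h

end Forward

/-! ### Reverse mode: the logical relation and its fundamental lemma -/

section Reverse

variable {U : Type} [NormedAddCommGroup U] [InnerProductSpace ℝ U] [CompleteSpace U]

/-- The logical relation for reverse mode: the plot `g` of primals is correct for the plot `f`, and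
the monoid homomorphisms `h u`, which pull cotangents of `τ` back to `U` (identified with its own
dual), are correct transposed derivatives of `f`.  At a function type, the homomorphism at a
singleton of the copower accounts for the dependence of the function on the point of `U`, and the
homomorphism of the argument for the dependence of the argument on it. -/
def RevRel : (τ : Ty) → (U → τ.sem) → (U → τ.rev₁.sem) → (U → (τ.rev₂.sem →+ U)) → Prop
  | .real n, f, g, h =>
    IsRev (Equiv.refl (Rn n)) (Equiv.refl (Rn n)) (Equiv.refl (Rn n)) f g (fun u => h u)
  | .unit, _, _, _ => True
  | .prod σ τ, f, g, h =>
    RevRel σ (fun u => (f u).1) (fun u => (g u).1)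
      (fun u => (h u).comp (AddMonoidHom.inl σ.rev₂.sem τ.rev₂.sem)) ∧
    RevRel τ (fun u => (f u).2) (fun u => (g u).2)
      (fun u => (h u).comp (AddMonoidHom.inr σ.rev₂.sem τ.rev₂.sem))
  | .fn σ τ, f, g, h => ∀ a a₁ a₂, RevRel σ a a₁ a₂ →
    RevRel τ (fun u => f u (a u)) (fun u => (g u (a₁ u)).1)
      (fun u => (h u).comp (Finsupp.singleAddHom (M := τ.rev₂.sem) (a₁ u)) +
        (a₂ u).comp (CTy.linear (L := τ.rev₂) (M := σ.rev₂) (g u (a₁ u)).2))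

/-- The reverse-mode logical relation on environments, entry by entry. -/
def RevEnvRel : (Γ : List Ty) → (U → Env Ty.sem Γ) → (U → Env CTy.sem (revCtx₁ Γ)) →
    (U → ((revCtx₂ Γ).sem →+ U)) → Prop
  | [], _, _, _ => True
  | τ :: Γ, f, g, h =>
    RevEnvRel Γ (fun u => (f u).1) (fun u => (g u).1)
      (fun u => (h u).comp (AddMonoidHom.inl (revCtx₂ Γ).sem τ.rev₂.sem)) ∧
    RevRel τ (fun u => (f u).2) (fun u => (g u).2)
      (fun u => (h u).comp (AddMonoidHom.inr (revCtx₂ Γ).sem τ.rev₂.sem))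

theorem RevRel.congr {τ : Ty} {f f' : U → τ.sem} {g g' : U → τ.rev₁.sem}
    {h h' : U → (τ.rev₂.sem →+ U)} (H : RevRel τ f g h) (hf : ∀ u, f' u = f u)
    (hg : ∀ u, g' u = g u) (hh : ∀ u w, h' u w = h u w) : RevRel τ f' g' h' := by
  rwa [funext hf, funext hg, funext fun u => AddMonoidHom.ext (hh u)]

theorem Ty.rev₂Coord_zero : ∀ {τ : Ty} (hτ : τ.FirstOrder), τ.rev₂Coord hτ 0 = 0
  | .real _, _ => rfl
  | .unit, _ => rfl
  | .prod _ _, hτ => (prodCoord_eq_iff.2 ⟨rev₂Coord_zero hτ.1, rev₂Coord_zero hτ.2⟩).trans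
      (map_zero _)

theorem Ty.rev₂Coord_add : ∀ {τ : Ty} (hτ : τ.FirstOrder) (a b : τ.rev₂.sem),
    τ.rev₂Coord hτ (a + b) = τ.rev₂Coord hτ a + τ.rev₂Coord hτ b
  | .real _, _, _, _ => rfl
  | .unit, _, _, _ => (add_zero _).symm
  | .prod _ _, hτ, _, _ =>
    (prodCoord_eq_iff.2 ⟨rev₂Coord_add hτ.1 _ _, rev₂Coord_add hτ.2 _ _⟩).trans (map_add _ _ _)

theorem ltupleCoord_zero {α : Type} {c : α → Type} [∀ a, Fintype (c a)] {f : α → LTy} :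
    ∀ {l : List α} {e : ∀ a ∈ l, (f a).sem ≃ E (c a)}, (∀ a ha, e a ha 0 = 0) →
      ltupleCoord f l e 0 = 0
  | [], _, _ => rfl
  | _ :: _, _, H => (prodCoord_eq_iff.2 ⟨ltupleCoord_zero fun a ha =>
      H a (List.mem_cons_of_mem _ ha), H _ List.mem_cons_self⟩).trans (map_zero _)

theorem ltupleCoord_add {α : Type} {c : α → Type} [∀ a, Fintype (c a)] {f : α → LTy} :
    ∀ {l : List α} {e : ∀ a ∈ l, (f a).sem ≃ E (c a)},
      (∀ a ha x y, e a ha (x + y) = e a ha x + e a ha y) →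
      ∀ x y, ltupleCoord f l e (x + y) = ltupleCoord f l e x + ltupleCoord f l e y
  | [], _, _, _, _ => (add_zero _).symm
  | _ :: _, _, H, _, _ => (prodCoord_eq_iff.2 ⟨ltupleCoord_add (fun a ha =>
      H a (List.mem_cons_of_mem _ ha)) _ _, H _ List.mem_cons_self _ _⟩).trans (map_add _ _ _)

theorem revRel_iff_isRev : ∀ {τ : Ty} (hτ : τ.FirstOrder) {f : U → τ.sem} {g : U → τ.rev₁.sem}
    {h : U → (τ.rev₂.sem →+ U)},
    RevRel τ f g h ↔
      IsRev (τ.coord hτ) (τ.rev₁Coord hτ) (τ.rev₂Coord hτ) f g (fun u => h u)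
  | .real _, _, _, _, _ => Iff.rfl
  | .unit, _, _, _, h => iff_of_true trivial (isRev_unit.2 fun u _ => map_zero (h u))
  | .prod _ _, hτ, _, _, _ =>
    (and_congr (revRel_iff_isRev hτ.1) (revRel_iff_isRev hτ.2)).trans
      (isRev_prod (Ty.rev₂Coord_zero hτ.1) (Ty.rev₂Coord_zero hτ.2)).symm

theorem revEnvRel_of_isRev : ∀ {Γ : List Ty} (hΓ : FirstOrderCtx Γ) {f : U → Env Ty.sem Γ}
    {g : U → Env CTy.sem (revCtx₁ Γ)} {h : U → ((revCtx₂ Γ).sem →+ U)},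
    IsRev (ctxCoord hΓ) (revCtx₁Coord hΓ) (revCtx₂Coord hΓ) f g (fun u => h u) →
      RevEnvRel Γ f g h
  | [], _, _, _, _, _ => trivial
  | _ :: _, hΓ, _, _, _, H =>
    have hΓ' := fun τ hτ => hΓ τ (List.mem_cons_of_mem _ hτ)
    have hτ := hΓ _ List.mem_cons_self
    have H := (isRev_prod (ltupleCoord_zero fun τ hτ => Ty.rev₂Coord_zero (hΓ' τ hτ))
      (Ty.rev₂Coord_zero hτ)).1 H
    ⟨revEnvRel_of_isRev hΓ' H.1, (revRel_iff_isRev hτ).2 H.2⟩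

/-- A tuple of related plots of real arrays is a smooth plot of argument lists; its transposed
derivative is the sum of those of the entries. -/
theorem isRev_args : ∀ {ns : List ℕ} {f : ∀ n, Var ns n → U → Rn n} {g : ∀ n, Var ns n → U → Rn n}
    {h : ∀ n, Var ns n → U → (Rn n →+ U)},
    (∀ n x, RevRel (.real n) (f n x) (g n x) (h n x)) →
    IsRev (argCoord ns) (argCtxCoord ns) (argTupleCoord ns)
      (fun u => Env.ofFun fun n x => f n x u) (fun u => argEnv fun n x => g n x u)
      (fun u => ltupleLift (f := LTy.real) fun n x => h n x u)
  | [], _, _, _, _ => isRev_unit.2 fun _ _ => rfl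
  | n :: ns, f, g, h, H => by
    refine (isRev_prod (ltupleCoord_zero fun _ _ => rfl) rfl).2 ⟨?_, ?_⟩
    · exact (isRev_args fun n x => H n (.there x)).congr fun u w =>
        (congrArg (_ + ·) (map_zero (h _ .here u))).trans (add_zero _)
    · exact IsRev.congr (H _ .here) fun u w => (congrArg (· + _) (map_zero
        (ltupleLift (f := LTy.real) fun n x => h n (.there x) u))).trans (zero_add _)

/-- Extending related environments by related values: the cotangents of the two parts are pulled back
separately and added. -/
theorem RevEnvRel.snoc {Γ : List Ty} {τ : Ty} {ρ : U → Env Ty.sem Γ}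
    {ρ₁ : U → Env CTy.sem (revCtx₁ Γ)} {ρ₂ : U → ((revCtx₂ Γ).sem →+ U)} {a : U → τ.sem}
    {a₁ : U → τ.rev₁.sem} {a₂ : U → (τ.rev₂.sem →+ U)} (H : RevEnvRel Γ ρ ρ₁ ρ₂)
    (ha : RevRel τ a a₁ a₂) :
    RevEnvRel (τ :: Γ) (fun u => (ρ u, a u)) (fun u => (ρ₁ u, a₁ u))
      (fun u => AddMonoidHom.coprod (ρ₂ u) (a₂ u)) := by
  refine ⟨?_, ha.congr (fun _ => rfl) (fun _ => rfl) fun u w =>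
    (congrArg (· + _) (map_zero (ρ₂ u))).trans (zero_add _)⟩
  convert H using 2 with u
  exact AddMonoidHom.coprod_comp_inl _ _

theorem RevEnvRel.lookup : ∀ {Γ : List Ty} {τ : Ty} (x : Var Γ τ) {ρ : U → Env Ty.sem Γ}
    {ρ₁ : U → Env CTy.sem (revCtx₁ Γ)} {ρ₂ : U → ((revCtx₂ Γ).sem →+ U)}
    {h : U → (τ.rev₂.sem →+ U)}, RevEnvRel Γ ρ ρ₁ ρ₂ → (∀ u w, h u w = ρ₂ u (ltupleSingle x w)) →
    RevRel τ (fun u => (ρ u).lookup x) (fun u => (ρ₁ u).lookup (x.map Ty.rev₁)) h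
  | _, _, .here, _, _, _, _, H, hh => RevRel.congr H.2 (fun _ => rfl) (fun _ => rfl) hh
  | _, _, .there x, _, _, _, _, H, hh => RevEnvRel.lookup x H.1 hh

/-- The denotation of the reverse transform of `op(t₁, …, tₖ)`, without the tuple `let`s. -/
theorem Tm.sem_rev_op (I : Interp S) (P : Derivs S) {Γ : List Ty} {ns : List ℕ} {m : ℕ}
    (o : S.Op ns m) (ts : ∀ n, Var ns n → Tm S Γ (.real n)) (ρ : Env CTy.sem (revCtx₁ Γ)) :
    ((Tm.op o ts).rev P).sem I ρ =
      (I.op o (Env.ofFun fun n x => Prod.fst (((ts n x).rev P).sem I ρ)),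
        ((LTm.sum fun n (x : Var ns n) => LTm.lapp (.snd ((ts n x).rev P))
            (LTm.proj (f := LTy.real) x .lvar)).sem I ρ).comp
          ((P.rev o).sem I (argEnv fun n x => Prod.fst (((ts n x).rev P).sem I ρ)))) := by
  refine sem_pletMany I ρ _ ns _ _ fun Δ r xs xs' ρ' _ hx hx' => Prod.ext ?_ ?_
  · exact congrArg (I.op o) (congrArg Env.ofFun (funext₂ hx))
  · refine AddMonoidHom.ext fun v => ?_
    change (LTm.sum fun n x => LTm.lapp (.var (xs' n x))
        (LTm.proj (f := LTy.real) x .lvar)).sem I ρ'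
          (((P.rev o).rename (argRen xs)).sem I ρ' v) =
      (LTm.sum fun n x => LTm.lapp (.snd ((ts n x).rev P))
        (LTm.proj (f := LTy.real) x .lvar)).sem I ρ ((P.rev o).sem I _ v)
    rw [LTm.sem_rename I _ fun _ => lookup_argRen ρ' xs]
    refine (LTm.sem_sum_proj I (AddMonoidHom.id _) _ _ _ _).trans <|
      Eq.trans ?_ (LTm.sem_sum_proj I (AddMonoidHom.id _) _ _ _ _).symm
    refine congrArg₂ (fun φ w => ltupleLift φ w) (funext₂ hx') ?_
    exact congrArg (fun e => (P.rev o).sem I (argEnv e) v) (funext₂ hx)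

/-- The fundamental lemma of the reverse-mode logical relation: the transform of a source term sends
related environments to related values. -/
theorem RevEnvRel.rev (I : Interp S) (P : Derivs S) (hP : P.RevCorrect I) {Γ : List Ty} {τ : Ty}
    (t : Tm S Γ τ) : ∀ {ρ : U → Env Ty.sem Γ}
    {ρ₁ : U → Env CTy.sem (revCtx₁ Γ)} {ρ₂ : U → ((revCtx₂ Γ).sem →+ U)}, RevEnvRel Γ ρ ρ₁ ρ₂ →
    RevRel τ (fun u => t.sem I (ρ u)) (fun u => Prod.fst ((t.rev P).sem I (ρ₁ u)))
      (fun u => (ρ₂ u).comp (CTy.linear (Prod.snd ((t.rev P).sem I (ρ₁ u))))) := by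
  induction t with
  | var x =>
    intro ρ ρ₁ ρ₂ H
    exact H.lookup x fun u w => congrArg (ρ₂ u) (LTm.sem_coproj I (ρ₁ u) w x .lvar)
  | letE t s iht ihs =>
    intro ρ ρ₁ ρ₂ H
    -- Cotangents of the extended context are pulled back to `U` by `ρ₂` on `Γ`, and through the
    -- transform of `t` on the new identifier.
    have h := ihs (H.snoc (iht H))
    simp only [Tm.rev, sem_plet, CTm.sem_wk]
    exact h.congr (fun _ => rfl) (fun _ => rfl) fun u w => map_add (ρ₂ u) _ _
  | op o ts ih =>
    intro ρ ρ₁ ρ₂ H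
    refine RevRel.congr (τ := .real _)
      (h := fun u => (ltupleLift fun n x => (ρ₂ u).comp (CTy.linear
        (Prod.snd (((ts n x).rev P).sem I (ρ₁ u))))).comp ((P.rev o).sem I (argEnv fun n x =>
          Prod.fst (((ts n x).rev P).sem I (ρ₁ u)))))
      ((isRev_args fun n x => ih n x H).comp (d₁ := Equiv.refl _) (d₂ := Equiv.refl _)
        (p₂ := fun x => (P.rev o).sem I x) (I.op_smooth o)
        (fun u => congrArg (I.op o) (congrArg Env.ofFun (funext₂ fun n x => (ih n x H).2.1 u)))
        (hP _ _ o))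
      (fun _ => rfl) (fun u => ?_) (fun u v => ?_)
    · exact congrArg Prod.fst (Tm.sem_rev_op I P o ts (ρ₁ u))
    · rw [Tm.sem_rev_op]
      exact LTm.sem_sum_proj I (ρ₂ u) (ρ₁ u) _ _ _
  | unit => exact fun _ => trivial
  | pair t s iht ihs =>
    intro ρ ρ₁ ρ₂ H
    simp only [Tm.rev, sem_plet, CTm.sem_wk]
    refine ⟨(iht H).congr (fun _ => rfl) (fun _ => rfl) fun u w => congrArg (ρ₂ u) ?_,
      (ihs H).congr (fun _ => rfl) (fun _ => rfl) fun u w => congrArg (ρ₂ u) ?_⟩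
    · exact (congrArg (_ + ·) (map_zero (CTy.linear (Prod.snd ((s.rev P).sem I (ρ₁ u)))))).trans
        (add_zero _)
    · exact (congrArg (· + _) (map_zero (CTy.linear (Prod.snd ((t.rev P).sem I (ρ₁ u)))))).trans
        (zero_add _)
  | fst t iht =>
    intro ρ ρ₁ ρ₂ H
    simp only [Tm.rev, sem_plet]
    exact (iht H).1
  | snd t iht =>
    intro ρ ρ₁ ρ₂ H
    simp only [Tm.rev, sem_plet]
    exact (iht H).2
  | lam t ih =>
    intro ρ ρ₁ ρ₂ H a a₁ a₂ ha
    refine (ih (H.snoc ha)).congr (fun _ => rfl) (fun _ => rfl) fun u w => ?_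
    -- At the singleton `!(a₁ u) ⊗ w`, the `case` over the copower runs its body at `a₁ u`.
    refine congrArg (ρ₂ u · + _) ?_
    exact Finsupp.liftAddHom_apply_single _ _ _
  | app t s iht ihs =>
    intro ρ ρ₁ ρ₂ H
    have h := iht H _ _ _ (ihs H)
    simp only [Tm.rev, sem_plet, CTm.sem_wk]
    exact h.congr (fun _ => rfl) (fun _ => rfl) fun u w => map_add (ρ₂ u) _ _

end Reverse

/-! ### Correctness at first-order types -/

/-- The identity plot of a first-order context is related to its primals and tangents. -/
theorem fwdEnvRel_id {Γ : List Ty} (hΓ : FirstOrderCtx Γ) :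
    FwdEnvRel Γ (fun x : E (CtxCoord Γ) => (ctxCoord hΓ).symm x)
      (fun x => (fwdCtx₁Coord hΓ).symm x) (fun _ v => (fwdCtx₂Coord hΓ).symm v) :=
  fwdEnvRel_of_isFwd hΓ ⟨by simpa using contDiff_fun_id, by simp, by simp⟩

/-- The identity plot of a first-order context is related to its primals and to the identity on
cotangents. -/
theorem revEnvRel_id {Γ : List Ty} (hΓ : FirstOrderCtx Γ) :
    RevEnvRel Γ (fun x : E (CtxCoord Γ) => (ctxCoord hΓ).symm x)
      (fun x => (revCtx₁Coord hΓ).symm x) (fun _ =>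
        { toFun := revCtx₂Coord hΓ
          map_zero' := ltupleCoord_zero fun τ hτ => Ty.rev₂Coord_zero (hΓ τ hτ)
          map_add' := ltupleCoord_add fun τ hτ => Ty.rev₂Coord_add (hΓ τ hτ) }) :=
  revEnvRel_of_isRev hΓ ⟨by simpa using contDiff_fun_id, by simp, fun _ _ => by
    simp only [Equiv.apply_symm_apply, fderiv_fun_id, ContinuousLinearMap.adjoint_id]
    rfl⟩

end CHAD

theorem mainTheorem1 {S : Signature.{u}} (I : Interp S) (P : Derivs S)
    (hfwd : P.FwdCorrect I) (hrev : P.RevCorrect I)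
    {Γ : List Ty} {τ : Ty} (hΓ : FirstOrderCtx Γ) (hτ : τ.FirstOrder) (t : Tm S Γ τ) :
    ContDiff ℝ ∞ (t.semCoord I hΓ hτ) ∧
    inCoords (fwdCtx₁Coord hΓ) (τ.fwd₁Coord hτ) ((t.fwd₁ P).sem I) = t.semCoord I hΓ hτ ∧
    (∀ x, inCoords (fwdCtx₂Coord hΓ) (τ.fwd₂Coord hτ)
      ((t.fwd₂ P).sem I ((fwdCtx₁Coord hΓ).symm x)) = D (t.semCoord I hΓ hτ) x) ∧
    inCoords (revCtx₁Coord hΓ) (τ.rev₁Coord hτ) ((t.rev₁ P).sem I) = t.semCoord I hΓ hτ ∧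
    (∀ x, inCoords (τ.rev₂Coord hτ) (revCtx₂Coord hΓ)
      ((t.rev₂ P).sem I ((revCtx₁Coord hΓ).symm x)) = Dt (t.semCoord I hΓ hτ) x) ∧
    (∀ x, fwdPairCoord hΓ hτ ((t.fwd P).sem I ((fwdCtx₁Coord hΓ).symm x)) =
      (t.semCoord I hΓ hτ x, D (t.semCoord I hΓ hτ) x)) ∧
    (∀ x, revPairCoord hΓ hτ ((t.rev P).sem I ((revCtx₁Coord hΓ).symm x)) =
      (t.semCoord I hΓ hτ x, Dt (t.semCoord I hΓ hτ) x)) := by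
  obtain ⟨smooth, f₁, f₂⟩ := (fwdRel_iff_isFwd hτ).1 ((fwdEnvRel_id hΓ).fwd I P hfwd t)
  obtain ⟨-, r₁, r₂⟩ := (revRel_iff_isRev hτ).1 ((revEnvRel_id hΓ).rev I P hrev t)
  have r₂' x : inCoords (τ.rev₂Coord hτ) (revCtx₂Coord hΓ)
      ((t.rev₂ P).sem I ((revCtx₁Coord hΓ).symm x)) = Dt (t.semCoord I hΓ hτ) x :=
    funext fun w => (r₂ x _).trans (congrArg _ ((τ.rev₂Coord hτ).apply_symm_apply w))
  exact ⟨smooth, funext f₁, fun x => funext (f₂ x), funext r₁, r₂',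
    fun x => Prod.ext (f₁ x) (funext (f₂ x)), fun x => Prod.ext (r₁ x) (r₂' x)⟩
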